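/- Let $A$ be a self-adjoint operator (bounded, or unbounded and semi-bounded from below) on an infinite-dimensional complex Hilbert space $\mathcal H$, let $\mathfrak a$ be the closed quadratic form of $A$, let $m=\min\sigma(A)$, and let $\mathcal H_{\mathfrak a}$ be ${\rm Dom}(\mathfrak a)$ with the norm $\Vert u\Vert_{\mathfrak a}=(\mathfrak a[u,u]-(m-1)\langle u,u\rangle)^{1/2}$. Let $\Delta=[a,b]$ with $a<b$, $a,b\in\rho(A)$ and $\sigma_{\rm ess}(A)\cap\Delta=\varnothing$. Let $\mathcal L(\Delta)$ be the span of the eigenvectors of $A$ with eigenvalues in $\Delta$, and let $E$ be the orthogonal projection onto $\mathcal L(\Delta)$. Let $(\mathcal L_n)$ be a sequence of finite-dimensional subspaces of $\mathcal H_{\mathfrak a}$ such that for every $u\in{\rm Dom}(\mathfrak a)$ there are $u_n\in\mathcal L_n$ with $\Vert u-u_n\Vert_{\mathfrak a}\to0$. For a finite-dimensional subspace $\mathcal K$ of $\mathcal H_{\mathfrak a}$, let $\sigma(A,\mathcal K)$ be the set of $\mu\in\mathbb R$ for which some non-zero $u\in\mathcal K$ satisfies $\mathfrak a[u,v]=\mu\langle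 u,v\rangle$ for all $v\in\mathcal K$. Let $\mathcal L_n(\Delta)$ be the span of those $u\in\mathcal L_n$ which satisfy $\mathfrak a[u,v]=\mu\langle u,v\rangle$ for all $v\in\mathcal L_n$, for some $\mu\in\Delta$, and let $Q_n$ be the orthogonal projection onto $\mathcal L_n(\Delta)$. Let $P$ be the orthogonal projection onto a fixed finite-dimensional subspace $\mathcal L$ of $\mathcal H$. For subspaces $\mathcal X,\mathcal Y$ put $\delta(\mathcal X,\mathcal Y)=\sup_{u\in\mathcal X,\Vert u\Vert=1}{\rm dist}(u,\mathcal Y)$ (equal to $0$ if $\mathcal X=\{0\}$) and $\hat\delta(\mathcal X,\mathcal Y)=\max\{\delta(\mathcal X,\mathcal Y),\delta(\mathcal Y,\mathcal X)\}$, and let $\hat\delta_{\mathfrak a}$ be the same quantity formed with the norm $\Vert\cdot\Vert_{\mathfrak a}$. Let $d_H$ be the Hausdorff distance, infinite if exactly one of the two sets is empty. Suppose that $\sigma(A)\cap\Delta=\{\lambda\}$ and ${\rm Rank}(PE)\neq0$. Then $\sigma_{\rm dis}(EPE)$ has a least element $\gamma$, and $\gamma>0$. Let $\mathcal M$ be the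 span of the eigenvectors of $EPE$ with eigenvalues in $[\gamma,1]$, and let $\mathcal M_n$ be the span of the eigenvectors of $Q_nP|_{\mathcal L_n(\Delta)}$ (an operator on $\mathcal L_n(\Delta)$) with eigenvalues in $[\gamma/2,1]$. Then $$\dim\mathcal M={\rm Rank}(PE),\qquad \mathcal M\subset\mathcal L(\Delta),$$ $$\hat\delta(\mathcal M_n,\mathcal M)\to0,\qquad \hat\delta_{\mathfrak a}(\mathcal M_n,\mathcal M)\to0,\qquad d_H(\sigma(A,\mathcal M_n),\{\lambda\})\to0.$$ -/

import Mathlib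

open Filter Topology Set
open scoped InnerProductSpace

noncomputable section

namespace Galerkin

variable {H : Type*} [NormedAddCommGroup H] [InnerProductSpace ℂ H]

/-! ### Operators, spectra and spectral subspaces

`LinearPMap` is Mathlib's type of (possibly unbounded) operators `A : Dom(A) → H`; a bounded
operator is an operator with domain `⊤`. Mathlib's inner product is linear in the *second* variable,
so the product written `⟨u, v⟩` in the literature (linear in `u`) is `⟪v, u⟫_ℂ`. -/

/-- `A` is bounded from below: `⟨A x, x⟩ ≥ c ‖x‖²` on `Dom(A)` for some real `c`. -/
def BoundedBelow (A : H →ₗ.[ℂ] H) : Prop :=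
  ∃ c : ℝ, ∀ x : A.domain, c * ‖(x : H)‖ ^ 2 ≤ (⟪(x : H), A x⟫_ℂ).re

/-- The resolvent set: those `z` such that `A - z : Dom(A) → H` has a bounded everywhere defined
inverse `R`. -/
def resolventSet (A : H →ₗ.[ℂ] H) : Set ℂ :=
  {z | ∃ R : H →L[ℂ] H,
    (∀ u : H, ∃ h : R u ∈ A.domain, A ⟨R u, h⟩ - z • R u = u) ∧
    ∀ u : A.domain, R (A u - z • (u : H)) = u}

/-- The spectrum. It is used for self-adjoint operators only, whose spectrum is real, and is
therefore recorded as a set of real numbers. -/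
def spec (A : H →ₗ.[ℂ] H) : Set ℝ := {x | (x : ℂ) ∉ resolventSet A}

/-- The subspace spanned by the eigenvectors of `A` whose eigenvalues lie in `S`. For a self-adjoint
`A` with `σ(A) ∩ S` a finite set of eigenvalues this is the spectral subspace for `S`. -/
def spectralSubspace (A : H →ₗ.[ℂ] H) (S : Set ℝ) : Submodule ℂ H :=
  Submodule.span ℂ {u | ∃ μ ∈ S, ∃ h : u ∈ A.domain, A ⟨u, h⟩ = (μ : ℂ) • u}

/-- The discrete spectrum of a self-adjoint operator: the isolated points of the spectrum which are
eigenvalues of finite multiplicity. -/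
def discSpec (A : H →ₗ.[ℂ] H) : Set ℝ :=
  {x | x ∈ spec A ∧ (∃ ε > 0, ∀ y ∈ spec A, |y - x| < ε → y = x) ∧
    spectralSubspace A {x} ≠ ⊥ ∧ FiniteDimensional ℂ (spectralSubspace A {x})}

/-- The essential spectrum of a self-adjoint operator. -/
def essSpec (A : H →ₗ.[ℂ] H) : Set ℝ := spec A \ discSpec A

/-- A bounded operator, as an operator with domain `H`. -/
def ofBounded (T : H →L[ℂ] H) : H →ₗ.[ℂ] H := (T : H →ₗ[ℂ] H).toPMap ⊤

/-- The orthogonal projection of `H` onto (the closure of) the subspace `K`. It is only used for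
subspaces which are finite-dimensional, hence closed; the closure is written because a projection is
available for every closed subspace without further side conditions. -/
def orthProj [CompleteSpace H] (K : Submodule ℂ H) : H →L[ℂ] H := K.topologicalClosure.starProjection

/-! ### The closed quadratic form of a semi-bounded self-adjoint operator -/

/-- `s` is a sequence in `Dom(A)` which converges to `u` in `H` and is Cauchy with respect to the form
`⟨A x, x⟩`. -/
def IsFormApprox (A : H →ₗ.[ℂ] H) (s : ℕ → A.domain) (u : H) : Prop :=
  Tendsto (fun n => (s n : H)) atTop (𝓝 u) ∧
  Tendsto (fun p : ℕ × ℕ => ⟪((s p.1 - s p.2 : A.domain) : H), A (s p.1 - s p.2)⟫_ℂ) atTop (𝓝 0)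

/-- The domain of the form `𝔞` of `A`, i.e. of the closure of `(x, y) ↦ ⟨A x, y⟩` on `Dom(A)`. -/
def formDomain (A : H →ₗ.[ℂ] H) : Set H := {u | ∃ s, IsFormApprox A s u}

/-- The form `𝔞[u, v]`, linear in `u` and conjugate linear in `v`: the common limit of
`⟨A sₙ, tₙ⟩` over all sequences `s`, `t` in `Dom(A)` approximating `u` and `v`. That this limit exists
for `u`, `v` in the form domain is `tendsto_form` below. -/
def form (A : H →ₗ.[ℂ] H) (u v : H) : ℂ :=
  Classical.epsilon fun z : ℂ => ∀ s t : ℕ → A.domain, IsFormApprox A s u → IsFormApprox A t v →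
    Tendsto (fun n => ⟪(t n : H), A (s n)⟫_ℂ) atTop (𝓝 z)

/-- The norm `‖u‖_𝔞 = (𝔞[u, u] - (m - 1) ⟨u, u⟩)^(1/2)`, where `m = min σ(A)`, of the Hilbert space
`H_𝔞` (the form domain). -/
def formNorm (A : H →ₗ.[ℂ] H) (u : H) : ℝ :=
  √((form A u u).re - (sInf (spec A) - 1) * ‖u‖ ^ 2)

/-! ### The gap between subspaces -/

/-- `δ(K, M) = sup {dist(u, M) : u ∈ K, N u = 1}`, where distances are measured by the norm `N`. -/
def delta (N : H → ℝ) (K M : Submodule ℂ H) : ℝ :=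
  sSup {d | ∃ u ∈ K, N u = 1 ∧ d = sInf {r | ∃ v ∈ M, r = N (u - v)}}

/-- The gap `max {δ(K, M), δ(M, K)}`, where distances are measured by the norm `N`. -/
def gap (N : H → ℝ) (K M : Submodule ℂ H) : ℝ := max (delta N K M) (delta N M K)

/-! ### Galerkin eigenvalues and subspaces -/

/-- `u ∈ K` satisfies `𝔞[u, v] = μ ⟨u, v⟩` for all `v ∈ K`. -/
def IsGalerkinVector (A : H →ₗ.[ℂ] H) (K : Submodule ℂ H) (μ : ℝ) (u : H) : Prop :=
  u ∈ K ∧ ∀ v ∈ K, form A u v = (μ : ℂ) * ⟪v, u⟫_ℂ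

/-- The set `σ(A, K)` of Galerkin eigenvalues of `A` with respect to the trial space `K`. -/
def galerkinSpec (A : H →ₗ.[ℂ] H) (K : Submodule ℂ H) : Set ℝ :=
  {μ | ∃ u, u ≠ 0 ∧ IsGalerkinVector A K μ u}

/-- The subspace `K(S)` spanned by the Galerkin eigenvectors with eigenvalues in `S`. -/
def galerkinSubspace (A : H →ₗ.[ℂ] H) (K : Submodule ℂ H) (S : Set ℝ) : Submodule ℂ H :=
  Submodule.span ℂ {u | ∃ μ ∈ S, IsGalerkinVector A K μ u}

/-- A sequence of trial spaces: finite-dimensional subspaces of the form domain such that each vector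
of the form domain is a limit, in the norm of `H_𝔞`, of vectors taken from them. -/
structure IsTrialSequence (A : H →ₗ.[ℂ] H) (L : ℕ → Submodule ℂ H) : Prop where
  finite : ∀ n, FiniteDimensional ℂ (L n)
  subset : ∀ n, (L n : Set H) ⊆ formDomain A
  approx : ∀ u ∈ formDomain A, ∃ s : ℕ → H, (∀ n, s n ∈ L n) ∧
    Tendsto (fun n => formNorm A (u - s n)) atTop (𝓝 0)

/-- For subspaces `K` and `W` with orthogonal projections `P` and `Q`, the compression `Q P|_W` of `P`
to `W`, as an operator with domain `W`. -/
def compression [CompleteSpace H] (K W : Submodule ℂ H) : H →ₗ.[ℂ] H :=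
  ((orthProj W ∘L orthProj K : H →L[ℂ] H) : H →ₗ[ℂ] H).toPMap W

/-! ### The form is well defined -/

section WellDefined

variable {A : H →ₗ.[ℂ] H}

/-- The shifted form `⟨A y, x⟩ - c ⟨y, x⟩` on `Dom(A)`. -/
def shifted (A : H →ₗ.[ℂ] H) (c : ℝ) (x y : A.domain) : ℂ :=
  ⟪(x : H), A y⟫_ℂ - (c : ℂ) * ⟪(x : H), (y : H)⟫_ℂ

theorem shifted_sub_left (c : ℝ) (x y z : A.domain) :
    shifted A c (x - y) z = shifted A c x z - shifted A c y z := by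
  simp only [shifted, Submodule.coe_sub, inner_sub_left]; ring

theorem shifted_sub_right (c : ℝ) (x y z : A.domain) :
    shifted A c x (y - z) = shifted A c x y - shifted A c x z := by
  simp only [shifted, Submodule.coe_sub, LinearPMap.map_sub, inner_sub_right]; ring

theorem shifted_add_left (c : ℝ) (x y z : A.domain) :
    shifted A c (x + y) z = shifted A c x z + shifted A c y z := by
  simp only [shifted, Submodule.coe_add, inner_add_left]; ring

theorem shifted_add_right (c : ℝ) (x y z : A.domain) :
    shifted A c x (y + z) = shifted A c x y + shifted A c x z := by
  simp only [shifted, Submodule.coe_add, LinearPMap.map_add, inner_add_right]; ring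

theorem shifted_self_nonneg {c : ℝ}
    (hc : ∀ x : A.domain, c * ‖(x : H)‖ ^ 2 ≤ (⟪(x : H), A x⟫_ℂ).re) (x : A.domain) :
    0 ≤ (shifted A c x x).re := by
  have h := hc x
  have h2 : ⟪(x : H), (x : H)⟫_ℂ = ((‖(x : H)‖ ^ 2 : ℝ) : ℂ) := by
    rw [inner_self_eq_norm_sq_to_K]; norm_cast
  rw [shifted, h2, ← Complex.ofReal_mul, Complex.sub_re, Complex.ofReal_re]
  linarith

theorem norm_shifted_le (hs : ∀ x y : A.domain, ⟪A x, (y : H)⟫_ℂ = ⟪(x : H), A y⟫_ℂ) {c : ℝ}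
    (hc : ∀ x : A.domain, c * ‖(x : H)‖ ^ 2 ≤ (⟪(x : H), A x⟫_ℂ).re) (x y : A.domain) :
    ‖shifted A c x y‖ ≤ √(shifted A c x x).re * √(shifted A c y y).re := by
  let core : PreInnerProductSpace.Core ℂ A.domain :=
    { inner := shifted A c
      conj_inner_symm := fun x y => by
        simp only [shifted, map_sub, map_mul, inner_conj_symm, Complex.conj_ofReal]
        rw [hs]
      re_inner_nonneg := shifted_self_nonneg hc
      add_left := shifted_add_left c
      smul_left := fun x y r => by
        simp only [shifted, Submodule.coe_smul, inner_smul_left]; ring }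
  exact @InnerProductSpace.Core.norm_inner_le_norm ℂ A.domain _ _ _ core x y

theorem shifted_sub_self_le {c : ℝ}
    (hc : ∀ x : A.domain, c * ‖(x : H)‖ ^ 2 ≤ (⟪(x : H), A x⟫_ℂ).re) (x y : A.domain) :
    (shifted A c (x - y) (x - y)).re ≤ 2 * (shifted A c x x).re + 2 * (shifted A c y y).re := by
  have h := shifted_self_nonneg hc (x + y)
  simp only [shifted_add_left, shifted_add_right, Complex.add_re] at h
  simp only [shifted_sub_left, shifted_sub_right, Complex.sub_re]
  linarith

theorem IsFormApprox.cauchy {s : ℕ → A.domain} {u : H} (h : IsFormApprox A s u) (c : ℝ) :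
    Tendsto (fun p : ℕ × ℕ => (shifted A c (s p.1 - s p.2) (s p.1 - s p.2)).re) atTop (𝓝 0) := by
  have h1 : Tendsto (fun p : ℕ × ℕ => ((s p.1 - s p.2 : A.domain) : H)) atTop (𝓝 0) := by
    rw [← prod_atTop_atTop_eq]
    simpa using (h.1.comp tendsto_fst).sub (h.1.comp tendsto_snd)
  have h2 := (h.2.sub ((h1.inner h1).const_mul (c : ℂ)))
  simp only [inner_zero_left, mul_zero, sub_zero] at h2
  have h3 := (Complex.continuous_re.tendsto _).comp h2
  rw [Complex.zero_re] at h3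
  exact h3

theorem shifted_small_iff {ι : Type*} {l : Filter ι} {f : ι → ℝ} (hf : ∀ i, 0 ≤ f i) :
    Tendsto f l (𝓝 0) ↔ ∀ ε > 0, ∀ᶠ i in l, f i ≤ ε := by
  constructor
  · intro h ε hε
    exact (h.eventually (gt_mem_nhds hε)).mono fun i hi => hi.le
  · intro h
    rw [Metric.tendsto_nhds]
    intro ε hε
    filter_upwards [h (ε / 2) (by positivity)] with i hi
    rw [Real.dist_eq, sub_zero, abs_of_nonneg (hf i)]
    linarith

theorem IsFormApprox.bounded {s : ℕ → A.domain} {u : H} (h : IsFormApprox A s u) {c : ℝ}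
    (hc : ∀ x : A.domain, c * ‖(x : H)‖ ^ 2 ≤ (⟪(x : H), A x⟫_ℂ).re) :
    ∃ B : ℝ, ∀ᶠ n in atTop, √(shifted A c (s n) (s n)).re ≤ B := by
  have h1 := (shifted_small_iff (fun _ => shifted_self_nonneg hc _)).1 (h.cauchy c) 1 one_pos
  obtain ⟨⟨N, N'⟩, hN⟩ := eventually_atTop.1 h1
  set M := max N N'
  refine ⟨√(2 * 1 + 2 * (shifted A c (-s M) (-s M)).re),
    eventually_atTop.2 ⟨M, fun n hn => Real.sqrt_le_sqrt ?_⟩⟩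
  have h2 := shifted_sub_self_le hc (s n - s M) (-s M)
  have h3 := hN (n, M) ⟨(le_max_left _ _).trans hn, le_max_right _ _⟩
  have h4 : s n - s M - (-s M) = s n := by abel
  rw [h4] at h2
  dsimp only at h3
  linarith

/-- Closability: two approximating sequences of the same vector are close in the form sense. -/
theorem IsFormApprox.sub_tendsto (hs : ∀ x y : A.domain, ⟪A x, (y : H)⟫_ℂ = ⟪(x : H), A y⟫_ℂ)
    {c : ℝ} (hc : ∀ x : A.domain, c * ‖(x : H)‖ ^ 2 ≤ (⟪(x : H), A x⟫_ℂ).re)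
    {s s' : ℕ → A.domain} {u : H} (h : IsFormApprox A s u) (h' : IsFormApprox A s' u) :
    Tendsto (fun n => (shifted A c (s n - s' n) (s n - s' n)).re) atTop (𝓝 0) := by
  have hpos := shifted_self_nonneg hc
  have hlim : Tendsto (fun n => ((s n - s' n : A.domain) : H)) atTop (𝓝 0) := by
    simpa using h.1.sub h'.1
  obtain ⟨B₁, hB₁⟩ := h.bounded hc
  obtain ⟨B₂, hB₂⟩ := h'.bounded hc
  set B := √(2 * B₁ ^ 2 + 2 * B₂ ^ 2) + 1
  have hBpos : 0 < B := by positivity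
  have hB : ∀ᶠ n in atTop, √(shifted A c (s n - s' n) (s n - s' n)).re ≤ B := by
    filter_upwards [hB₁, hB₂] with n h1 h2
    have e1 := (Real.sqrt_le_left ((Real.sqrt_nonneg _).trans h1)).1 h1
    have e2 := (Real.sqrt_le_left ((Real.sqrt_nonneg _).trans h2)).1 h2
    have e3 := shifted_sub_self_le hc (s n) (s' n)
    exact (Real.sqrt_le_sqrt (by linarith)).trans (lt_add_one _).le
  rw [shifted_small_iff (fun _ => hpos _)]
  intro ε hε
  have hδ : 0 < (ε / (2 * B)) ^ 2 := by positivity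
  have k1 := (shifted_small_iff (fun _ => hpos _)).1 (h.cauchy c) _ (div_pos hδ four_pos)
  have k2 := (shifted_small_iff (fun _ => hpos _)).1 (h'.cauchy c) _ (div_pos hδ four_pos)
  rw [← prod_atTop_atTop_eq] at k1 k2
  filter_upwards [hB, k1.curry, k2.curry] with n hn hk1 hk2
  have hw : Tendsto (fun m => ‖shifted A c (s n - s' n) (s m - s' m)‖) atTop (𝓝 0) := by
    have : ∀ m, shifted A c (s n - s' n) (s m - s' m) =
        ⟪A (s n - s' n) - (c : ℂ) • ((s n - s' n : A.domain) : H),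
          ((s m - s' m : A.domain) : H)⟫_ℂ := by
      intro m
      rw [shifted, ← hs, inner_sub_left, inner_smul_left, Complex.conj_ofReal]
    simp_rw [this]
    have h0 := (Tendsto.inner (𝕜 := ℂ) (tendsto_const_nhds
      (x := A (s n - s' n) - (c : ℂ) • ((s n - s' n : A.domain) : H))) hlim).norm
    rw [inner_zero_right, norm_zero] at h0
    exact h0
  obtain ⟨m, hm1, hm2, hm3⟩ := (hk1.and (hk2.and
    ((shifted_small_iff (fun _ => norm_nonneg _)).1 hw (ε / 2) (by positivity)))).exists
  have hd : √(shifted A c ((s n - s' n) - (s m - s' m)) ((s n - s' n) - (s m - s' m))).re ≤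
      ε / (2 * B) := by
    rw [Real.sqrt_le_left (by positivity)]
    have e := shifted_sub_self_le hc (s n - s m) (s' n - s' m)
    have e2 : s n - s m - (s' n - s' m) = (s n - s' n) - (s m - s' m) := by abel
    rw [e2] at e
    linarith
  have hsplit : shifted A c (s n - s' n) (s n - s' n) =
      shifted A c (s n - s' n) ((s n - s' n) - (s m - s' m)) +
        shifted A c (s n - s' n) (s m - s' m) := by
    rw [← shifted_add_right, sub_add_cancel]
  calc (shifted A c (s n - s' n) (s n - s' n)).re
      ≤ ‖shifted A c (s n - s' n) (s n - s' n)‖ := Complex.re_le_norm _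
    _ ≤ ‖shifted A c (s n - s' n) ((s n - s' n) - (s m - s' m))‖ +
        ‖shifted A c (s n - s' n) (s m - s' m)‖ := by rw [hsplit]; exact norm_add_le _ _
    _ ≤ B * (ε / (2 * B)) + ε / 2 := by
        gcongr
        exact (norm_shifted_le hs hc _ _).trans (mul_le_mul hn hd (Real.sqrt_nonneg _) hBpos.le)
    _ = ε := by field_simp; ring

theorem IsFormApprox.sub_tendsto₂ (hs : ∀ x y : A.domain, ⟪A x, (y : H)⟫_ℂ = ⟪(x : H), A y⟫_ℂ)
    {c : ℝ} (hc : ∀ x : A.domain, c * ‖(x : H)‖ ^ 2 ≤ (⟪(x : H), A x⟫_ℂ).re)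
    {s s' : ℕ → A.domain} {u : H} (h : IsFormApprox A s u) (h' : IsFormApprox A s' u) :
    Tendsto (fun p : ℕ × ℕ => √(shifted A c (s p.1 - s' p.2) (s p.1 - s' p.2)).re)
      atTop (𝓝 0) := by
  have hpos := shifted_self_nonneg hc
  have h1 := (h.cauchy c).const_mul 2
  have h2 := ((h.sub_tendsto hs hc h').comp
    (tendsto_snd (f := (atTop : Filter ℕ)) (g := (atTop : Filter ℕ)))).const_mul 2
  rw [prod_atTop_atTop_eq] at h2
  have h3 := h1.add h2
  simp only [mul_zero, add_zero] at h3
  have h4 : Tendsto (fun p : ℕ × ℕ => (shifted A c (s p.1 - s' p.2) (s p.1 - s' p.2)).re)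
      atTop (𝓝 0) := by
    refine squeeze_zero (fun _ => hpos _) (fun p => ?_) h3
    have e := shifted_sub_self_le hc (s p.1 - s p.2) (s' p.2 - s p.2)
    have e2 : s p.1 - s p.2 - (s' p.2 - s p.2) = s p.1 - s' p.2 := by abel
    have e3 : shifted A c (s' p.2 - s p.2) (s' p.2 - s p.2) =
        shifted A c (s p.2 - s' p.2) (s p.2 - s' p.2) := by
      simp only [shifted_sub_left, shifted_sub_right]; ring
    rw [e2, e3] at e
    exact e
  simpa using h4.sqrt

theorem shifted_diff_tendsto (hs : ∀ x y : A.domain, ⟪A x, (y : H)⟫_ℂ = ⟪(x : H), A y⟫_ℂ)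
    {c : ℝ} (hc : ∀ x : A.domain, c * ‖(x : H)‖ ^ 2 ≤ (⟪(x : H), A x⟫_ℂ).re)
    {s s' t t' : ℕ → A.domain} {u v : H} (h : IsFormApprox A s u) (h' : IsFormApprox A s' u)
    (k : IsFormApprox A t v) (k' : IsFormApprox A t' v) :
    Tendsto (fun p : ℕ × ℕ => shifted A c (t p.1) (s p.1) - shifted A c (t' p.2) (s' p.2))
      atTop (𝓝 0) := by
  obtain ⟨B₁, hB₁⟩ := k.bounded hc
  obtain ⟨B₂, hB₂⟩ := h'.bounded hc
  have e1 := (h.sub_tendsto₂ hs hc h').const_mul B₁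
  have e2 := (k.sub_tendsto₂ hs hc k').mul_const B₂
  have e3 := e1.add e2
  simp only [mul_zero, zero_mul, add_zero] at e3
  have b1 : ∀ᶠ p : ℕ × ℕ in atTop, √(shifted A c (t p.1) (t p.1)).re ≤ B₁ := by
    rw [← prod_atTop_atTop_eq]; exact tendsto_fst.eventually hB₁
  have b2 : ∀ᶠ p : ℕ × ℕ in atTop, √(shifted A c (s' p.2) (s' p.2)).re ≤ B₂ := by
    rw [← prod_atTop_atTop_eq]; exact tendsto_snd.eventually hB₂
  refine squeeze_zero_norm' ?_ e3
  filter_upwards [b1, b2] with p h1 h2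
  have e : shifted A c (t p.1) (s p.1) - shifted A c (t' p.2) (s' p.2) =
      shifted A c (t p.1) (s p.1 - s' p.2) + shifted A c (t p.1 - t' p.2) (s' p.2) := by
    rw [shifted_sub_left, shifted_sub_right]; ring
  rw [e]
  refine (norm_add_le _ _).trans (add_le_add ?_ ?_)
  · exact (norm_shifted_le hs hc _ _).trans (mul_le_mul_of_nonneg_right h1 (Real.sqrt_nonneg _))
  · exact (norm_shifted_le hs hc _ _).trans (mul_le_mul_of_nonneg_left h2 (Real.sqrt_nonneg _))

/-- For a symmetric operator which is bounded from below, `𝔞[u, v]` is the limit of `⟨A sₙ, tₙ⟩` for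
all approximating sequences `s` of `u` and `t` of `v`. -/
theorem tendsto_form (hs : ∀ x y : A.domain, ⟪A x, (y : H)⟫_ℂ = ⟪(x : H), A y⟫_ℂ)
    (hb : BoundedBelow A) {s t : ℕ → A.domain} {u v : H} (h : IsFormApprox A s u)
    (k : IsFormApprox A t v) :
    Tendsto (fun n => ⟪(t n : H), A (s n)⟫_ℂ) atTop (𝓝 (form A u v)) := by
  obtain ⟨c, hc⟩ := hb
  have hcauchy : CauchySeq fun n => shifted A c (t n) (s n) := by
    rw [cauchySeq_iff_tendsto_dist_atTop_0]
    simpa [dist_eq_norm] using (shifted_diff_tendsto hs hc h h k k).norm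
  obtain ⟨z, hz⟩ := cauchySeq_tendsto_of_complete hcauchy
  have key : ∃ z : ℂ, ∀ s t : ℕ → A.domain, IsFormApprox A s u → IsFormApprox A t v →
      Tendsto (fun n => ⟪(t n : H), A (s n)⟫_ℂ) atTop (𝓝 z) := by
    refine ⟨z + c * ⟪v, u⟫_ℂ, fun s' t' h' k' => ?_⟩
    have d := (shifted_diff_tendsto hs hc h h' k k').comp
      (tendsto_atTop_diagonal : Tendsto (fun n : ℕ => (n, n)) atTop atTop)
    have e := (hz.sub d).add ((k'.1.inner h'.1).const_mul (c : ℂ))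
    rw [sub_zero] at e
    refine e.congr fun n => ?_
    simp [shifted]
  exact Classical.epsilon_spec key s t h k

/-- On `Dom(A)` the form is `⟨A x, y⟩`. -/
theorem form_eq (hs : ∀ x y : A.domain, ⟪A x, (y : H)⟫_ℂ = ⟪(x : H), A y⟫_ℂ)
    (hb : BoundedBelow A) (x y : A.domain) : form A x y = ⟪(y : H), A x⟫_ℂ := by
  have h : ∀ x : A.domain, IsFormApprox A (fun _ => x) x := fun x =>
    ⟨tendsto_const_nhds, by simp⟩
  exact tendsto_nhds_unique (tendsto_form hs hb (h x) (h y)) tendsto_const_nhds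

end WellDefined

end Galerkin

end

/-!
Write `V` for the eigenspace of `ev`, which is the spectral subspace of `[a, b]`, let `E` and `Qₙ` be
the orthogonal projections onto `V` and onto the Galerkin subspaces `Wₙ` of `[a, b]`, and let `P` be the
orthogonal projection onto `K`. The span of the eigenvectors of the compression of `P` to `Wₙ` with
eigenvalues in `[γ / 2, 1]` is denoted by `Mₙ`, and the trial spaces by `Lₙ`.

The heart of the matter is that `Qₙ u → E u` in the norm of `H_𝔞` for every `u : H`
(`tendsto_formNorm_orthProj_sub`). The spaces `Wₙ` may contain spurious vectors, but these converge
weakly to zero. Two arguments prove this, both without strong resolvent convergence.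

* For `w ∈ V` the part of an approximation `z ∈ Lₙ` of `w` which is orthogonal to `Wₙ` is small, because
  the form of `A - ev` is definite there up to the sign of the Galerkin operator
  (`IsSemibounded.formNorm_sub_orthProj_le`).
* On `Vᗮ` the operator `A - c`, with `c` the midpoint of `[a, b]`, has an inverse `S` of norm less than
  `2 / (b - a)`, since `a` and `b` are in the resolvent set and
  `ev` is the only point of the spectrum between them
  (`IsResolvent.exists_reducedResolvent`, by the functional calculus of the bounded operator
  `(A - a)⁻¹`). The Galerkin operator minus `c` has norm at most `(b - a) / 2` on `Wₙ`, so
  `‖Qₙ u‖ ≤ ((b - a) / 2) ‖Qₙ (S u)‖ + o(1)` for `u ∈ Vᗮ`. Iterating this inequality shows `Qₙ u → 0`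
  (`tendsto_orthProj_compl`).

As `P` has finite rank, `Qₙ P - E P E` tends to zero uniformly on the unit spheres of `Wₙ`, even in the
norm of `H_𝔞`
(`exists_compression_error`). The non-zero spectrum of `E P E` consists of the finitely many non-zero
Ritz values of `P` on `V`, of which `γ` is the smallest, while zero has infinite multiplicity because
`H` is infinite-dimensional (`mem_discSpec_sandwich_iff`). Hence the spectral subspaces for `[γ / 2, 1]`
of the compressions converge to that of `E P E`, uniformly and in both norms (`exists_lower_error`,
`exists_upper_error`). Finally a Galerkin eigenvalue on `Mₙ` is a Rayleigh quotient of a vector close to an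
eigenvector with eigenvalue `ev`, and so it is close to `ev`
(`IsSemibounded.abs_sub_le_of_mem_galerkinSpec`).

Galerkin vectors and the eigenvectors of the compressions are treated alike, as Ritz vectors of a
Hermitian form on a finite-dimensional space (`ritzSpan`, `IsRitzBasis`).
-/

namespace Galerkin

variable {H : Type*} [NormedAddCommGroup H] [InnerProductSpace ℂ H]

/-! ### Hermitian forms on finite-dimensional spaces -/

theorem inner_self_eq_ofReal (v : H) : ⟪v, v⟫_ℂ = ((‖v‖ ^ 2 : ℝ) : ℂ) := by
  rw [inner_self_eq_norm_sq_to_K]; exact (Complex.ofReal_pow _ _).symm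

/-- `q` is a Hermitian form on the subspace `D`, linear in the first variable. Outside `D` the
function `q` is arbitrary. -/
structure IsHermitianOn (q : H → H → ℂ) (D : Submodule ℂ H) : Prop where
  add_left : ∀ u ∈ D, ∀ v ∈ D, ∀ w ∈ D, q (u + v) w = q u w + q v w
  smul_left : ∀ r : ℂ, ∀ u ∈ D, ∀ v ∈ D, q (r • u) v = r * q u v
  conj_symm : ∀ u ∈ D, ∀ v ∈ D, starRingEnd ℂ (q v u) = q u v

/-- The span of the Ritz vectors of the form `q` on `V` with Ritz values in `S`: those `u ∈ V` with
`q(u, v) = μ ⟨u, v⟩` for all `v ∈ V`, for some `μ ∈ S`. -/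
def ritzSpan (q : H → H → ℂ) (V : Submodule ℂ H) (S : Set ℝ) : Submodule ℂ H :=
  Submodule.span ℂ {u | ∃ μ ∈ S, u ∈ V ∧ ∀ v ∈ V, q u v = (μ : ℂ) * ⟪v, u⟫_ℂ}

/-- `e` is an orthonormal basis of `V` which diagonalizes the form `q`, with Ritz values `μ`. -/
structure IsRitzBasis (q : H → H → ℂ) (V : Submodule ℂ H) {ι : Type*} [Fintype ι] (e : ι → H)
    (μ : ι → ℝ) : Prop where
  orthonormal : Orthonormal ℂ e
  mem : ∀ i, e i ∈ V
  sum_repr : ∀ u ∈ V, ∑ i, ⟪e i, u⟫_ℂ • e i = u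
  form_left : ∀ i, ∀ v ∈ V, q (e i) v = (μ i : ℂ) * ⟪v, e i⟫_ℂ

theorem ritzSpan_le (q : H → H → ℂ) (V : Submodule ℂ H) (S : Set ℝ) : ritzSpan q V S ≤ V :=
  Submodule.span_le.2 fun _ ⟨_, _, h, _⟩ => h

namespace IsHermitianOn

variable {q : H → H → ℂ} {D : Submodule ℂ H}

theorem mono (h : IsHermitianOn q D) {V : Submodule ℂ H} (hV : V ≤ D) : IsHermitianOn q V :=
  ⟨fun u hu v hv w hw => h.add_left u (hV hu) v (hV hv) w (hV hw),
    fun r u hu v hv => h.smul_left r u (hV hu) v (hV hv),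
    fun u hu v hv => h.conj_symm u (hV hu) v (hV hv)⟩

theorem zero_left (h : IsHermitianOn q D) {u : H} (hu : u ∈ D) : q 0 u = 0 := by
  simpa using h.smul_left 0 u hu u hu

theorem add_right (h : IsHermitianOn q D) {u v w : H} (hu : u ∈ D) (hv : v ∈ D) (hw : w ∈ D) :
    q u (v + w) = q u v + q u w := by
  rw [← h.conj_symm u hu _ (D.add_mem hv hw), h.add_left v hv w hw u hu, map_add,
    h.conj_symm u hu v hv, h.conj_symm u hu w hw]

theorem smul_right (h : IsHermitianOn q D) (r : ℂ) {u v : H} (hu : u ∈ D) (hv : v ∈ D) :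
    q u (r • v) = starRingEnd ℂ r * q u v := by
  rw [← h.conj_symm u hu _ (D.smul_mem r hv), h.smul_left r v hv u hu, map_mul,
    h.conj_symm u hu v hv]

theorem sub_left (h : IsHermitianOn q D) {u v w : H} (hu : u ∈ D) (hv : v ∈ D) (hw : w ∈ D) :
    q (u - v) w = q u w - q v w := by
  rw [sub_eq_add_neg, ← neg_one_smul ℂ v, h.add_left u hu _ (D.smul_mem _ hv) w hw,
    h.smul_left _ v hv w hw]
  ring

theorem sub_right (h : IsHermitianOn q D) {u v w : H} (hu : u ∈ D) (hv : v ∈ D) (hw : w ∈ D) :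
    q u (v - w) = q u v - q u w := by
  rw [← h.conj_symm u hu _ (D.sub_mem hv hw), h.sub_left hv hw hu, map_sub,
    h.conj_symm u hu v hv, h.conj_symm u hu w hw]

theorem sum_left (h : IsHermitianOn q D) {ι : Type*} (s : Finset ι) {f : ι → H}
    (hf : ∀ i, f i ∈ D) {v : H} (hv : v ∈ D) : q (∑ i ∈ s, f i) v = ∑ i ∈ s, q (f i) v := by
  classical
  induction s using Finset.induction_on with
  | empty => simpa using h.zero_left hv
  | insert i s hi ih =>
    rw [Finset.sum_insert hi, Finset.sum_insert hi,
      h.add_left _ (hf i) _ (D.sum_mem fun j _ => hf j) v hv, ih]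

/-- The spectral theorem for a Hermitian form on a finite-dimensional space. -/
theorem exists_ritzBasis (h : IsHermitianOn q D) [FiniteDimensional ℂ D] :
    ∃ (e : Fin (Module.finrank ℂ D) → H) (μ : Fin (Module.finrank ℂ D) → ℝ),
      IsRitzBasis q D e μ := by
  set f := stdOrthonormalBasis ℂ D
  -- the operator `S` with `⟨S u, v⟩ = q(u, v)`
  let S : D →ₗ[ℂ] D :=
    { toFun := fun u => ∑ i, q u (f i) • f i
      map_add' := fun u v => by
        simp only [Submodule.coe_add, h.add_left _ u.2 _ v.2 _ (f _).2, add_smul,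
          Finset.sum_add_distrib]
      map_smul' := fun r u => by
        simp only [Submodule.coe_smul, h.smul_left r _ u.2 _ (f _).2, mul_smul,
          Finset.smul_sum, RingHom.id_apply] }
  have hS : ∀ u v : D, ⟪v, S u⟫_ℂ = q u v := by
    intro u v
    have hv : (v : H) = ∑ i, ⟪f i, v⟫_ℂ • (f i : H) := by
      conv_lhs => rw [← f.sum_repr' v]
      simp
    have h1 : q v u = ∑ i, ⟪f i, v⟫_ℂ * q (f i) u := by
      conv_lhs => rw [hv]
      rw [h.sum_left _ (fun i => D.smul_mem _ (f i).2) u.2]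
      exact Finset.sum_congr rfl fun i _ => h.smul_left _ _ (f i).2 _ u.2
    rw [← h.conj_symm u u.2 v v.2, h1, map_sum]
    simp only [S, LinearMap.coe_mk, AddHom.coe_mk, inner_sum, inner_smul_right, map_mul,
      inner_conj_symm, h.conj_symm u u.2 _ (f _).2]
    exact Finset.sum_congr rfl fun i _ => mul_comm _ _
  have hsymm : S.IsSymmetric := fun u v => by
    rw [← inner_conj_symm, hS, hS, h.conj_symm _ v.2 _ u.2]
  refine ⟨fun i => hsymm.eigenvectorBasis rfl i, hsymm.eigenvalues rfl, ?_, fun i => Subtype.prop _,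
    ?_, ?_⟩
  · exact (hsymm.eigenvectorBasis rfl).orthonormal.comp_linearIsometry D.subtypeₗᵢ
  · intro u hu
    have := (hsymm.eigenvectorBasis rfl).sum_repr' ⟨u, hu⟩
    have := congrArg (Subtype.val) this
    simpa using this
  · intro i v hv
    rw [← hS _ ⟨v, hv⟩, hsymm.apply_eigenvectorBasis, inner_smul_right]
    rfl

end IsHermitianOn

namespace IsRitzBasis

variable {q : H → H → ℂ} {V : Submodule ℂ H} {ι : Type*} [Fintype ι] {e : ι → H} {μ : ι → ℝ}

theorem inner_eq_sum (he : IsRitzBasis q V e μ) {u : H} (hu : u ∈ V) (v : H) :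
    ⟪v, u⟫_ℂ = ∑ i, ⟪e i, u⟫_ℂ * ⟪v, e i⟫_ℂ := by
  conv_lhs => rw [← he.sum_repr u hu]
  rw [inner_sum]
  simp only [inner_smul_right]

theorem form_eq_sum (he : IsRitzBasis q V e μ) (hq : IsHermitianOn q V) {u v : H} (hu : u ∈ V)
    (hv : v ∈ V) : q u v = ∑ i, (μ i : ℂ) * (⟪e i, u⟫_ℂ * ⟪v, e i⟫_ℂ) := by
  conv_lhs => rw [← he.sum_repr u hu]
  rw [hq.sum_left _ (fun i => V.smul_mem _ (he.mem i)) hv]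
  refine Finset.sum_congr rfl fun i _ => ?_
  rw [hq.smul_left _ _ (he.mem i) _ hv, he.form_left i v hv]
  ring

theorem norm_sq_eq_sum (he : IsRitzBasis q V e μ) {u : H} (hu : u ∈ V) :
    ‖u‖ ^ 2 = ∑ i, ‖⟪e i, u⟫_ℂ‖ ^ 2 := by
  have h := he.inner_eq_sum hu u
  rw [inner_self_eq_ofReal] at h
  have h2 : ∀ i, ⟪e i, u⟫_ℂ * ⟪u, e i⟫_ℂ = ((‖⟪e i, u⟫_ℂ‖ ^ 2 : ℝ) : ℂ) := by
    intro i
    rw [← inner_conj_symm u, Complex.mul_conj, Complex.normSq_eq_norm_sq]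
  simp only [h2] at h
  refine Complex.ofReal_injective ?_
  rw [Complex.ofReal_sum, ← h]

theorem form_self_re (he : IsRitzBasis q V e μ) (hq : IsHermitianOn q V) {u : H} (hu : u ∈ V) :
    (q u u).re = ∑ i, μ i * ‖⟪e i, u⟫_ℂ‖ ^ 2 := by
  have h2 : ∀ i, (μ i : ℂ) * (⟪e i, u⟫_ℂ * ⟪u, e i⟫_ℂ) = ((μ i * ‖⟪e i, u⟫_ℂ‖ ^ 2 : ℝ) : ℂ) := by
    intro i
    rw [← inner_conj_symm u, Complex.mul_conj, Complex.normSq_eq_norm_sq]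
    push_cast; rfl
  rw [he.form_eq_sum hq hu hu]
  simp only [h2]
  rw [← Complex.ofReal_sum, Complex.ofReal_re]

theorem inner_diag (he : IsRitzBasis q V e μ) (f : ι → ℂ) (u : H) (j : ι) :
    ⟪e j, ∑ i, (f i * ⟪e i, u⟫_ℂ) • e i⟫_ℂ = f j * ⟪e j, u⟫_ℂ :=
  he.orthonormal.inner_right_fintype _ j

theorem diag_mem (he : IsRitzBasis q V e μ) (f : ι → ℂ) (u : H) :
    ∑ i, (f i * ⟪e i, u⟫_ℂ) • e i ∈ V :=
  V.sum_mem fun i _ => V.smul_mem _ (he.mem i)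

theorem norm_diag_le (he : IsRitzBasis q V e μ) {f : ι → ℂ} {u : H} (hu : u ∈ V) {C : ℝ}
    (hC : 0 ≤ C) (h : ∀ i, ⟪e i, u⟫_ℂ ≠ 0 → ‖f i‖ ≤ C) :
    ‖∑ i, (f i * ⟪e i, u⟫_ℂ) • e i‖ ≤ C * ‖u‖ := by
  refine le_of_sq_le_sq ?_ (by positivity)
  rw [he.norm_sq_eq_sum (he.diag_mem f u), mul_pow, he.norm_sq_eq_sum hu, Finset.mul_sum]
  refine Finset.sum_le_sum fun i _ => ?_
  rw [he.inner_diag, norm_mul, mul_pow]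
  by_cases h0 : ⟪e i, u⟫_ℂ = 0
  · simp [h0]
  · have := h i h0
    gcongr

theorem form_self_le (he : IsRitzBasis q V e μ) (hq : IsHermitianOn q V) {u : H} (hu : u ∈ V)
    {C : ℝ} (h : ∀ i, ⟪e i, u⟫_ℂ ≠ 0 → μ i ≤ C) : (q u u).re ≤ C * ‖u‖ ^ 2 := by
  rw [he.form_self_re hq hu, he.norm_sq_eq_sum hu, Finset.mul_sum]
  refine Finset.sum_le_sum fun i _ => ?_
  by_cases h0 : ⟪e i, u⟫_ℂ = 0
  · simp [h0]
  · have := h i h0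
    gcongr

theorem norm_form_sub_le (he : IsRitzBasis q V e μ) (hq : IsHermitianOn q V) {u v : H}
    (hu : u ∈ V) (hv : v ∈ V) {c r : ℝ} (hr : 0 ≤ r)
    (h : ∀ i, ⟪e i, u⟫_ℂ ≠ 0 → |μ i - c| ≤ r) :
    ‖q u v - c * ⟪v, u⟫_ℂ‖ ≤ r * ‖u‖ * ‖v‖ := by
  have h1 : q u v - c * ⟪v, u⟫_ℂ = ⟪v, ∑ i, (((μ i - c : ℝ) : ℂ) * ⟪e i, u⟫_ℂ) • e i⟫_ℂ := by
    rw [he.form_eq_sum hq hu hv, he.inner_eq_sum hu, Finset.mul_sum, ← Finset.sum_sub_distrib,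
      inner_sum]
    refine Finset.sum_congr rfl fun i _ => ?_
    rw [inner_smul_right]; push_cast; ring
  rw [h1, mul_comm]
  refine (norm_inner_le_norm _ _).trans ?_
  gcongr
  refine he.norm_diag_le hu hr fun i hi => ?_
  rw [Complex.norm_real]
  exact h i hi

/-- The Ritz vectors with Ritz values in `S` span the vectors without components along the basis
vectors whose Ritz values lie outside `S`. -/
theorem mem_ritzSpan (he : IsRitzBasis q V e μ) (hq : IsHermitianOn q V) {S : Set ℝ} {u : H} :
    u ∈ ritzSpan q V S ↔ u ∈ V ∧ ∀ i, μ i ∉ S → ⟪e i, u⟫_ℂ = 0 := by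
  constructor
  · intro hu
    refine ⟨ritzSpan_le _ _ _ hu, fun i hi => ?_⟩
    induction hu using Submodule.span_induction with
    | mem u hu =>
      obtain ⟨ν, hν, huV, hu⟩ := hu
      have h1 := hu _ (he.mem i)
      rw [← hq.conj_symm u huV _ (he.mem i), he.form_left i u huV, map_mul, Complex.conj_ofReal,
        inner_conj_symm] at h1
      have h2 : ((μ i - ν : ℝ) : ℂ) * ⟪e i, u⟫_ℂ = 0 := by push_cast; rw [sub_mul, h1, sub_self]
      refine (mul_eq_zero.1 h2).resolve_left fun h3 => hi ?_
      rw [Complex.ofReal_eq_zero, sub_eq_zero] at h3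
      rwa [h3]
    | zero => exact inner_zero_right _
    | add x y _ _ hx hy => rw [inner_add_right, hx, hy, add_zero]
    | smul r x _ hx => rw [inner_smul_right, hx, mul_zero]
  · rintro ⟨hu, h⟩
    rw [← he.sum_repr u hu]
    refine Submodule.sum_mem _ fun i _ => ?_
    by_cases hi : μ i ∈ S
    · exact Submodule.smul_mem _ _ (Submodule.subset_span ⟨μ i, hi, he.mem i, he.form_left i⟩)
    · rw [h i hi, zero_smul]; exact Submodule.zero_mem _

theorem basis_mem_ritzSpan (he : IsRitzBasis q V e μ) {S : Set ℝ} {i : ι} (hi : μ i ∈ S) :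
    e i ∈ ritzSpan q V S :=
  Submodule.subset_span ⟨μ i, hi, he.mem i, he.form_left i⟩

/-- The coordinates of `x ∈ V` which is orthogonal to the Ritz vectors with Ritz values in `S`. -/
theorem mem_of_orthogonal (he : IsRitzBasis q V e μ) {S : Set ℝ} {x : H}
    (hx : ∀ w ∈ ritzSpan q V S, ⟪w, x⟫_ℂ = 0) {i : ι} (hi : ⟪e i, x⟫_ℂ ≠ 0) : μ i ∉ S :=
  fun h => hi (hx _ (he.basis_mem_ritzSpan h))

/-- A spectral subspace of a form and its orthogonal complement are also orthogonal with respect to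
the form. -/
theorem form_eq_zero_of_orthogonal (he : IsRitzBasis q V e μ) (hq : IsHermitianOn q V) {S : Set ℝ}
    {x v : H} (hxV : x ∈ V) (hx : ∀ w ∈ ritzSpan q V S, ⟪w, x⟫_ℂ = 0) (hv : v ∈ ritzSpan q V S) :
    q x v = 0 := by
  rw [he.form_eq_sum hq hxV (ritzSpan_le _ _ _ hv)]
  refine Finset.sum_eq_zero fun i _ => ?_
  by_cases hi : ⟪e i, x⟫_ℂ = 0
  · simp [hi]
  · rw [← inner_conj_symm v, ((he.mem_ritzSpan hq).1 hv).2 i (he.mem_of_orthogonal hx hi)]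
    simp

end IsRitzBasis

/-! ### Orthogonal projections onto finite-dimensional subspaces -/

section Projection

variable [CompleteSpace H] (K : Submodule ℂ H) [FiniteDimensional ℂ K]

theorem orthProj_eq_starProjection : orthProj K = K.starProjection := by
  have h : K.topologicalClosure = K :=
    (Submodule.closed_of_finiteDimensional K).submodule_topologicalClosure_eq
  ext u
  refine (Submodule.eq_starProjection_of_mem_of_inner_eq_zero
    (K := K) ?_ fun w hw => ?_).symm
  · exact h.le (K.topologicalClosure.starProjection_apply_mem u)
  · exact Submodule.starProjection_inner_eq_zero _ _ (K.le_topologicalClosure hw)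

theorem orthProj_mem (u : H) : orthProj K u ∈ K := by
  rw [orthProj_eq_starProjection]; exact K.starProjection_apply_mem u

theorem inner_sub_orthProj (u : H) {w : H} (hw : w ∈ K) : ⟪w, u - orthProj K u⟫_ℂ = 0 := by
  rw [orthProj_eq_starProjection, ← inner_conj_symm, K.starProjection_inner_eq_zero u w hw, map_zero]

theorem inner_orthProj_right (u : H) {w : H} (hw : w ∈ K) : ⟪w, orthProj K u⟫_ℂ = ⟪w, u⟫_ℂ := by
  have := inner_sub_orthProj K u hw
  rw [inner_sub_right, sub_eq_zero] at this
  exact this.symm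

theorem inner_orthProj_left (u v : H) : ⟪orthProj K u, v⟫_ℂ = ⟪u, orthProj K v⟫_ℂ := by
  rw [orthProj_eq_starProjection]; exact K.inner_starProjection_left_eq_right u v

theorem orthProj_eq_self {u : H} (hu : u ∈ K) : orthProj K u = u := by
  rw [orthProj_eq_starProjection]; exact K.starProjection_eq_self_iff.2 hu

theorem eq_orthProj {u v : H} (hv : v ∈ K) (h : ∀ w ∈ K, ⟪w, u - v⟫_ℂ = 0) : orthProj K u = v := by
  rw [orthProj_eq_starProjection]
  refine Submodule.eq_starProjection_of_mem_of_inner_eq_zero hv fun w hw => ?_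
  rw [← inner_conj_symm, h w hw, map_zero]

theorem norm_orthProj_le (u : H) : ‖orthProj K u‖ ≤ ‖u‖ := by
  rw [orthProj_eq_starProjection]; exact K.norm_starProjection_apply_le u

end Projection

/-! ### Self-adjoint operators and their resolvents -/

theorem isSymmetric_of_isSelfAdjoint [CompleteSpace H] {A : H →ₗ.[ℂ] H} (hA : IsSelfAdjoint A)
    (x y : A.domain) : ⟪A x, (y : H)⟫_ℂ = ⟪(x : H), A y⟫_ℂ := by
  have h := LinearPMap.adjoint_isFormalAdjoint hA.dense_domain
  rw [LinearPMap.isSelfAdjoint_def.1 hA] at h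
  exact h x y

/-- `B` is the resolvent `(A - a)⁻¹` of `A` at the point `a`. -/
def IsResolvent (A : H →ₗ.[ℂ] H) (a : ℂ) (B : H →L[ℂ] H) : Prop :=
  (∀ u : H, ∃ h : B u ∈ A.domain, A ⟨B u, h⟩ - a • B u = u) ∧
    ∀ u : A.domain, B (A u - a • (u : H)) = u

theorem exists_isResolvent {A : H →ₗ.[ℂ] H} {x : ℝ} (h : x ∉ spec A) :
    ∃ B, IsResolvent A x B := not_not.1 h

theorem isResolvent_apply_iff {A : H →ₗ.[ℂ] H} {a : ℂ} {B : H →L[ℂ] H} (hB : IsResolvent A a B)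
    {u v : H} : B u = v ↔ ∃ h : v ∈ A.domain, A ⟨v, h⟩ = u + a • v := by
  constructor
  · rintro rfl
    obtain ⟨h, h'⟩ := hB.1 u
    exact ⟨h, sub_eq_iff_eq_add.1 h'⟩
  · rintro ⟨h, h'⟩
    have := hB.2 ⟨v, h⟩
    rw [h'] at this
    simpa using this

theorem mem_spec_of_eigenvector {A : H →ₗ.[ℂ] H} {μ : ℝ} {u : H} (hu : u ≠ 0) (h : u ∈ A.domain)
    (hAu : A ⟨u, h⟩ = (μ : ℂ) • u) : μ ∈ spec A := by
  intro hμ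
  obtain ⟨R, -, hR⟩ := hμ
  have := hR ⟨u, h⟩
  rw [hAu, sub_self, map_zero] at this
  exact hu this.symm

namespace IsResolvent

variable {A : H →ₗ.[ℂ] H} {a : ℝ} {B : H →L[ℂ] H}

theorem isSelfAdjoint [CompleteSpace H] (hB : IsResolvent A a B)
    (hs : ∀ x y : A.domain, ⟪A x, (y : H)⟫_ℂ = ⟪(x : H), A y⟫_ℂ) : IsSelfAdjoint B := by
  rw [ContinuousLinearMap.isSelfAdjoint_iff_isSymmetric]
  intro u v
  obtain ⟨hu, hu'⟩ := (isResolvent_apply_iff hB).1 (rfl : B u = B u)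
  obtain ⟨hv, hv'⟩ := (isResolvent_apply_iff hB).1 (rfl : B v = B v)
  have h := hs ⟨_, hu⟩ ⟨_, hv⟩
  rw [hu', hv', inner_add_left, inner_add_right, inner_smul_left, inner_smul_right,
    Complex.conj_ofReal] at h
  have h2 : ⟪B u, v⟫_ℂ = ⟪u, B v⟫_ℂ := by
    simp only at h
    linear_combination -h
  exact h2

/-- The spectral mapping theorem for the resolvent: the non-zero points of its spectrum are the
points `(x - a)⁻¹` with `x` in the spectrum of `A`. -/
theorem mem_spec_iff (hB : IsResolvent A a B) {x : ℝ} (hx : x ≠ a) :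
    x ∈ spec A ↔ (x - a)⁻¹ ∈ spectrum ℝ B := by
  have hxa : x - a ≠ 0 := sub_ne_zero.2 hx
  have hxc : (x : ℂ) - a ≠ 0 := by exact_mod_cast hxa
  have hB2 : ∀ (u : H) (h : u ∈ A.domain), B (A ⟨u, h⟩) = u + (a : ℂ) • B u := fun u h => by
    have := hB.2 ⟨u, h⟩
    rw [map_sub, map_smul, sub_eq_iff_eq_add] at this
    exact this
  rw [← not_iff_not, spectrum.notMem_iff]
  have hU : IsUnit ((algebraMap ℝ (H →L[ℂ] H)) (x - a)⁻¹ - B) ↔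
      IsUnit (1 - ((x : ℂ) - a) • B) := by
    have : (1 - ((x : ℂ) - a) • B) =
        (algebraMap ℝ (H →L[ℂ] H) (x - a)) * ((algebraMap ℝ (H →L[ℂ] H)) (x - a)⁻¹ - B) := by
      rw [mul_sub, ← map_mul, mul_inv_cancel₀ hxa, map_one, ← Algebra.smul_def]
      congr 1
      ext u
      simp [← Complex.coe_smul]
    rw [this]
    exact ((((isUnit_iff_ne_zero.2 hxa).map (algebraMap ℝ (H →L[ℂ] H))).mul_left_iff)).symm
  rw [hU]
  simp only [spec, mem_ofPred_eq, not_not]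
  constructor
  · rintro ⟨R, hR⟩
    have hR : IsResolvent A x R := hR
    rw [isUnit_iff_exists]
    refine ⟨1 + ((x : ℂ) - a) • R, ?_, ?_⟩
    · ext u
      obtain ⟨h, hu⟩ := (isResolvent_apply_iff hR).1 (rfl : R u = R u)
      have h1 := hB2 _ h
      rw [hu, map_add, map_smul] at h1
      simp only [mul_apply_eq_comp, add_apply,
        sub_apply, one_apply_eq_self,
        smul_apply, map_add, map_smul]
      have h2 : B u = R u - ((x : ℂ) - a) • B (R u) := by
        rw [sub_smul, ← sub_eq_zero, ← sub_eq_zero.2 h1]; abel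
      conv_lhs => rw [h2]
      module
    · ext u
      obtain ⟨h, hu⟩ := (isResolvent_apply_iff hB).1 (rfl : B u = B u)
      have h1 := hR.2 ⟨_, h⟩
      rw [hu] at h1
      simp only [map_sub, map_add, map_smul] at h1
      simp only [mul_apply_eq_comp, add_apply,
        sub_apply, one_apply_eq_self,
        smul_apply, map_sub, map_smul]
      have h2 : R u = B u + ((x : ℂ) - a) • R (B u) := by
        rw [sub_smul, ← sub_eq_zero, ← sub_eq_zero.2 h1]; abel
      conv_lhs => rw [h2]
      module
  · intro h
    obtain ⟨G, hG1, hG2⟩ := isUnit_iff_exists.1 h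
    have hcomm : B * G = G * B := by
      have h1 : B * (1 - ((x : ℂ) - a) • B) = (1 - ((x : ℂ) - a) • B) * B := by
        simp [mul_sub, sub_mul]
      calc B * G = G * (1 - ((x : ℂ) - a) • B) * (B * G) := by rw [hG2, one_mul]
        _ = G * (B * (1 - ((x : ℂ) - a) • B)) * G := by rw [h1]; simp only [mul_assoc]
        _ = G * B := by rw [mul_assoc, mul_assoc, hG1, mul_one]
    refine ⟨B * G, fun u => ?_, fun u => ?_⟩
    · have h1 : G u - ((x : ℂ) - a) • B (G u) = u := by
        have := congrArg (fun T : H →L[ℂ] H => T u) hG1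
        simpa using this
      obtain ⟨h, hu⟩ := (isResolvent_apply_iff hB).1 (rfl : B (G u) = B (G u))
      refine ⟨h, ?_⟩
      simp only [mul_apply_eq_comp]
      rw [hu]
      conv_rhs => rw [← h1]
      module
    · have h1 : G u - ((x : ℂ) - a) • G (B u) = u := by
        have := congrArg (fun T : H →L[ℂ] H => T u) hG2
        simpa using this
      rw [hcomm, mul_apply_eq_comp, map_sub, hB2 _ u.2, map_sub, map_add, map_smul,
        map_smul, map_smul]
      conv_rhs => rw [← h1]
      module

end IsResolvent

/-! ### Consequences of the functional calculus for the resolvent -/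

theorem continuousOn_ite_lt {f : ℝ → ℝ} {t α : ℝ} (hf : ContinuousOn f (Iio t)) {s : Set ℝ}
    (hs : t ∉ s) : ContinuousOn (fun y => if y < t then f y else α) s := by
  intro y hy
  refine ContinuousAt.continuousWithinAt ?_
  rcases lt_trichotomy y t with h | h | h
  · refine (hf.continuousAt (Iio_mem_nhds h)).congr ?_
    filter_upwards [Iio_mem_nhds h] with z hz
    exact (if_pos hz).symm
  · exact absurd (h ▸ hy) hs
  · refine (continuousAt_const (y := α)).congr ?_
    filter_upwards [Ioi_mem_nhds h] with z hz
    exact (if_neg (not_lt.2 (le_of_lt hz))).symm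

theorem mul_cfc_self [CompleteSpace H] {B : H →L[ℂ] H} (hB : IsSelfAdjoint B) {f : ℝ → ℝ}
    (hf : ContinuousOn f (spectrum ℝ B)) : B * cfc f B = cfc (fun y => y * f y) B := by
  conv_lhs => rw [← cfc_id' ℝ B]
  rw [cfc_id' ℝ B, cfc_mul (fun y => y) f B continuousOn_id hf, cfc_id' ℝ B]

namespace IsResolvent

variable [CompleteSpace H] {A : H →ₗ.[ℂ] H} {a : ℝ} {B : H →L[ℂ] H}

/-- The numerical range and the spectrum have the same lower bounds: with `B = (A - a)⁻¹`, both
conditions say that `B + (a - c) B² ≥ 0`. -/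
theorem lowerBound_iff (hB : IsResolvent A a B)
    (hs : ∀ x y : A.domain, ⟪A x, (y : H)⟫_ℂ = ⟪(x : H), A y⟫_ℂ) (c : ℝ) :
    (∀ x : A.domain, c * ‖(x : H)‖ ^ 2 ≤ (⟪(x : H), A x⟫_ℂ).re) ↔ ∀ x ∈ spec A, c ≤ x := by
  have hsa := hB.isSelfAdjoint hs
  have hcont : ContinuousOn (fun y : ℝ => y + (a - c) * y ^ 2) (spectrum ℝ B) := by fun_prop
  have key : 0 ≤ cfc (fun y : ℝ => y + (a - c) * y ^ 2) B ↔
      ∀ y ∈ spectrum ℝ B, 0 ≤ y + (a - c) * y ^ 2 := cfc_nonneg_iff _ _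
  have hT : cfc (fun y : ℝ => y + (a - c) * y ^ 2) B = B + (a - c) • B ^ 2 := by
    rw [cfc_add B (fun y => y) (fun y : ℝ => (a - c) * y ^ 2),
      cfc_const_mul (a - c) (fun y : ℝ => y ^ 2) B, cfc_pow_id B 2, cfc_id' ℝ B]
  have hsym : ∀ u v, ⟪B u, v⟫_ℂ = ⟪u, B v⟫_ℂ :=
    (ContinuousLinearMap.isSelfAdjoint_iff_isSymmetric.1 hsa)
  have hval : ∀ u : H, ⟪(B + (a - c) • B ^ 2) u, u⟫_ℂ = ⟪B u, u⟫_ℂ + (a - c : ℝ) * ⟪B u, B u⟫_ℂ := by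
    intro u
    rw [add_apply, inner_add_left, smul_apply, ← Complex.coe_smul, inner_smul_left,
      Complex.conj_ofReal, pow_two, mul_apply_eq_comp, hsym (B u)]
  have h1 : 0 ≤ cfc (fun y : ℝ => y + (a - c) * y ^ 2) B ↔
      ∀ u, 0 ≤ (⟪B u, u⟫_ℂ).re + (a - c) * ‖B u‖ ^ 2 := by
    rw [ContinuousLinearMap.nonneg_iff_isPositive, ContinuousLinearMap.isPositive_def']
    simp only [cfc_predicate (fun y : ℝ => y + (a - c) * y ^ 2) B, true_and]
    refine forall_congr' fun u => ?_
    rw [ContinuousLinearMap.reApplyInnerSelf_apply, hT, hval, inner_self_eq_ofReal, ← Complex.ofReal_mul]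
    rw [RCLike.re_eq_complex_re, Complex.add_re, Complex.ofReal_re]
  have h2 : (∀ u, 0 ≤ (⟪B u, u⟫_ℂ).re + (a - c) * ‖B u‖ ^ 2) ↔
      ∀ x : A.domain, c * ‖(x : H)‖ ^ 2 ≤ (⟪(x : H), A x⟫_ℂ).re := by
    constructor
    · intro h x
      have := h (A x - (a : ℂ) • (x : H))
      rw [hB.2, inner_sub_right, inner_smul_right, inner_self_eq_ofReal, ← Complex.ofReal_mul, Complex.sub_re,
        Complex.ofReal_re] at this
      linarith
    · intro h u
      obtain ⟨hu, hu'⟩ := hB.1 u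
      have := h ⟨B u, hu⟩
      have h3 : ⟪B u, u⟫_ℂ = ⟪B u, A ⟨B u, hu⟩ - (a : ℂ) • B u⟫_ℂ := by rw [hu']
      rw [h3, inner_sub_right, inner_smul_right, inner_self_eq_ofReal, ← Complex.ofReal_mul, Complex.sub_re,
        Complex.ofReal_re]
      simp only at this
      linarith
  rw [← h2, ← h1, key]
  constructor
  · intro h x hx
    have hxa : x ≠ a := by
      rintro rfl
      exact hx ⟨B, hB⟩
    have h3 := h _ ((hB.mem_spec_iff hxa).1 hx)
    have h4 : x - a ≠ 0 := sub_ne_zero.2 hxa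
    have h5 : (x - a)⁻¹ + (a - c) * (x - a)⁻¹ ^ 2 = (x - c) * ((x - a)⁻¹) ^ 2 := by
      field_simp; ring
    rw [h5] at h3
    have := nonneg_of_mul_nonneg_left h3 (by positivity)
    linarith
  · intro h y hy
    by_cases hy0 : y = 0
    · simp [hy0]
    · have h3 : a + y⁻¹ ∈ spec A := by
        rw [hB.mem_spec_iff (by simpa using hy0)]
        simpa using hy
      have h4 := h _ h3
      have h5 : y + (a - c) * y ^ 2 = (a + y⁻¹ - c) * y ^ 2 := by field_simp; ring
      rw [h5]
      exact mul_nonneg (by linarith) (by positivity)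

/-- Spectral separation: if `ev` is the only point of the spectrum in `[a, b]`, then there are the
orthogonal projection `E` onto the eigenspace of `ev` and a right inverse `S` of `A - (a + b) / 2` on
the orthogonal complement of the eigenspace, whose norm is less than `2 / (b - a)`. Both are functions
of the resolvent at `a`. -/
theorem exists_reducedResolvent (hB : IsResolvent A a B)
    (hs : ∀ x y : A.domain, ⟪A x, (y : H)⟫_ℂ = ⟪(x : H), A y⟫_ℂ) {b ev : ℝ}
    (hb : b ∉ spec A) (hev : Icc a b ∩ spec A = {ev}) :
    ∃ E S : H →L[ℂ] H,
      (∀ u, ∃ h : E u ∈ A.domain, A ⟨E u, h⟩ = (ev : ℂ) • E u) ∧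
      (∀ (u : H) (h : u ∈ A.domain), A ⟨u, h⟩ = (ev : ℂ) • u → E u = u) ∧
      (∀ u v, ⟪E u, v⟫_ℂ = ⟪u, E v⟫_ℂ) ∧
      (∀ w, E (S w) = 0) ∧
      (∀ w, ∃ h : S w ∈ A.domain, A ⟨S w, h⟩ - (((a + b) / 2 : ℝ) : ℂ) • S w = w - E w) ∧
      (b - a) / 2 * ‖S‖ < 1 := by
  have hsa := hB.isSelfAdjoint hs
  have ha : a ∉ spec A := fun h => h ⟨B, hB⟩
  have hmem : ev ∈ Icc a b ∩ spec A := by rw [hev]; rfl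
  obtain ⟨⟨hae, heb⟩, hes⟩ := hmem
  have hae : a < ev := lt_of_le_of_ne hae fun h => ha (h ▸ hes)
  have heb : ev < b := lt_of_le_of_ne heb fun h => hb (h ▸ hes)
  obtain ⟨r, hr⟩ : ∃ r, r = (b - a) / 2 := ⟨_, rfl⟩
  have hr0 : 0 < r := by rw [hr]; linarith
  have hea : 0 < ev - a := by linarith
  set y₀ := (ev - a)⁻¹ with hy₀
  -- the image of `b` under `x ↦ (x - a)⁻¹`, which separates `y₀` from the rest of the spectrum
  set t := (2 * r)⁻¹ with ht
  have ht0 : 0 < t := by positivity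
  have hty : t < y₀ := by
    rw [ht, hy₀]; exact inv_strictAnti₀ hea (by rw [hr]; linarith)
  have hsp : ∀ y ∈ spectrum ℝ B, y < t ∨ y = y₀ := by
    intro y hy
    by_contra! hcon
    obtain ⟨h1, h2⟩ := hcon
    have hy0 : 0 < y := ht0.trans_le h1
    have h3 : a + y⁻¹ ∈ spec A := by
      rw [hB.mem_spec_iff (by simpa using hy0.ne')]
      simpa using hy
    have h4 : y⁻¹ ≤ 2 * r := by
      have := inv_anti₀ ht0 h1
      rwa [ht, inv_inv] at this
    have h5 : a + y⁻¹ ∈ Icc a b ∩ spec A :=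
      ⟨⟨by have := inv_pos.2 hy0; linarith, by rw [hr] at h4; linarith⟩, h3⟩
    rw [hev] at h5
    apply h2
    rw [hy₀, ← (show a + y⁻¹ = ev from h5)]
    simp
  have hts : t ∉ spectrum ℝ B := fun h => by
    rcases hsp t h with h | h
    · exact lt_irrefl _ h
    · exact hty.ne h
  have hden : ∀ y, y < t → 0 < 1 - r * y := fun y hy => by
    have : r * y < r * t := by gcongr
    rw [ht] at this
    have h2 : r * (2 * r)⁻¹ = 1 / 2 := by field_simp
    linarith
  set f : ℝ → ℝ := fun y => if y < t then 0 else 1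
  set k : ℝ → ℝ := fun y => if y < t then (y - y₀)⁻¹ else 0
  set g : ℝ → ℝ := fun y => if y < t then y / (1 - r * y) else 0
  have hf : ContinuousOn f (spectrum ℝ B) := continuousOn_ite_lt continuousOn_const hts
  have hk : ContinuousOn k (spectrum ℝ B) := by
    refine continuousOn_ite_lt (ContinuousOn.inv₀ (by fun_prop) fun y hy => ?_) hts
    exact sub_ne_zero.2 ((show y < t from hy).trans hty).ne
  have hg : ContinuousOn g (spectrum ℝ B) := by
    refine continuousOn_ite_lt (ContinuousOn.div (by fun_prop) (by fun_prop) fun y hy => ?_) hts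
    exact (hden y hy).ne'
  have hy₀t : ¬ y₀ < t := hty.not_gt
  have hB1 : B * cfc f B = y₀ • cfc f B := by
    rw [mul_cfc_self hsa hf, ← cfc_const_mul y₀ f B hf]
    refine cfc_congr fun y hy => ?_
    rcases hsp y hy with h | rfl
    · simp [f, h]
    · rfl
  have hB2 : 1 - cfc f B = cfc k B * (B - y₀ • 1) := by
    have e1 : B - y₀ • 1 = cfc (fun y => y - y₀) B := by
      rw [cfc_sub (fun y => y) (fun _ => y₀) B, cfc_id' ℝ B, cfc_const y₀ B,
        Algebra.algebraMap_eq_smul_one]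
    rw [e1, ← cfc_mul k _ B hk (by fun_prop), ← cfc_const_one ℝ B, ← cfc_sub _ f B (by fun_prop) hf]
    refine cfc_congr fun y hy => ?_
    rcases hsp y hy with h | rfl
    · have : y - y₀ ≠ 0 := sub_ne_zero.2 (h.trans hty).ne
      simp [f, k, h, this]
    · simp [f, hy₀t]
  have hES : cfc f B * cfc g B = 0 := by
    rw [← cfc_mul f g B hf hg, ← cfc_const_zero ℝ B]
    refine cfc_congr fun y hy => ?_
    rcases hsp y hy with h | rfl
    · simp [f, h]
    · simp [g, hy₀t]
  have hS : cfc g B = B * (1 - cfc f B + r • cfc g B) := by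
    rw [← cfc_const_one ℝ B, ← cfc_sub _ f B (by fun_prop) hf, ← cfc_const_mul r g B hg,
      ← cfc_add B (fun y => 1 - f y) (fun y => r * g y) (by fun_prop) (by fun_prop),
      mul_cfc_self hsa (by fun_prop)]
    refine cfc_congr fun y hy => ?_
    rcases hsp y hy with h | rfl
    · have := div_mul_cancel₀ y (hden y h).ne'
      simp only [f, g, h, if_true]
      linear_combination this
    · simp [f, g, hy₀t]
  refine ⟨cfc f B, cfc g B, fun u => ?_, fun u h hu => ?_, ?_, fun w => ?_, fun w => ?_, ?_⟩
  · have h1 : B (((ev - a : ℝ) : ℂ) • cfc f B u) = cfc f B u := by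
      have h2 := congrArg (fun T : H →L[ℂ] H => T u) hB1
      simp only [mul_apply_eq_comp, smul_apply] at h2
      rw [map_smul, h2, Complex.coe_smul, smul_smul, hy₀, mul_inv_cancel₀ hea.ne', one_smul]
    obtain ⟨h, h'⟩ := (isResolvent_apply_iff hB).1 h1
    refine ⟨h, ?_⟩
    rw [h', ← add_smul]
    congr 1
    push_cast; ring
  · have h1 : B ((ev - a : ℂ) • u) = u :=
      (isResolvent_apply_iff hB).2 ⟨h, by rw [hu]; module⟩
    have h2 := congrArg (fun T : H →L[ℂ] H => T u) hB2
    have h3 : (B - y₀ • (1 : H →L[ℂ] H)) u = 0 := by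
      rw [map_smul] at h1
      have h4 : ((ev : ℂ) - a) ≠ 0 := by exact_mod_cast hea.ne'
      rw [sub_apply, smul_apply, one_apply_eq_self, sub_eq_zero]
      calc B u = (y₀ : ℂ) • ((ev - a : ℂ) • B u) := by
            rw [smul_smul, hy₀, Complex.ofReal_inv, Complex.ofReal_sub, inv_mul_cancel₀ h4, one_smul]
        _ = y₀ • u := by rw [h1, Complex.coe_smul]
    simp only [mul_apply_eq_comp] at h2
    rw [h3, map_zero, sub_apply, one_apply_eq_self, sub_eq_zero] at h2
    exact h2.symm
  · exact ContinuousLinearMap.isSelfAdjoint_iff_isSymmetric.1 (cfc_predicate f B)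
  · have := congrArg (fun T : H →L[ℂ] H => T w) hES
    simpa using this
  · have h1 : B (w - cfc f B w + (r : ℂ) • cfc g B w) = cfc g B w := by
      have := congrArg (fun T : H →L[ℂ] H => T w) hS
      simp only [mul_apply_eq_comp, add_apply, sub_apply, one_apply_eq_self, smul_apply] at this
      rw [Complex.coe_smul]
      exact this.symm
    obtain ⟨h, h'⟩ := (isResolvent_apply_iff hB).1 h1
    refine ⟨h, ?_⟩
    rw [h', hr]
    push_cast
    module
  · rw [← hr]
    have : ‖cfc g B‖ < r⁻¹ := by
      refine norm_cfc_lt (by positivity) fun y hy => ?_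
      rcases hsp y hy with h | rfl
      · have h1 := hden y h
        have h2 : r * y < r * t := by gcongr
        have h3 : r * t = 1 / 2 := by rw [ht]; field_simp
        simp only [g, h, if_true]
        rw [Real.norm_eq_abs, abs_div, abs_of_pos h1, div_lt_iff₀ h1, abs_lt, inv_mul_eq_div,
          ← neg_div, div_lt_iff₀ hr0, lt_div_iff₀ hr0]
        constructor <;> linarith
      · simp [g, hy₀t, hr0]
    calc r * ‖cfc g B‖ < r * r⁻¹ := by gcongr
      _ = 1 := mul_inv_cancel₀ hr0.ne'

end IsResolvent

/-! ### The form domain as a pre-Hilbert space -/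

/-- `A` is symmetric and the infimum of its spectrum is a lower bound of its numerical range. For a
self-adjoint semi-bounded `A` the second property is a theorem, see
`IsResolvent.isSemibounded`. -/
structure IsSemibounded (A : H →ₗ.[ℂ] H) : Prop where
  symm : ∀ x y : A.domain, ⟪A x, (y : H)⟫_ℂ = ⟪(x : H), A y⟫_ℂ
  lower : ∀ x : A.domain, sInf (spec A) * ‖(x : H)‖ ^ 2 ≤ (⟪(x : H), A x⟫_ℂ).re

theorem IsResolvent.isSemibounded [CompleteSpace H] {A : H →ₗ.[ℂ] H} {a : ℝ} {B : H →L[ℂ] H}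
    (hB : IsResolvent A a B) (hs : ∀ x y : A.domain, ⟪A x, (y : H)⟫_ℂ = ⟪(x : H), A y⟫_ℂ)
    (hb : BoundedBelow A) : IsSemibounded A := by
  refine ⟨hs, (hB.lowerBound_iff hs _).2 fun x hx => csInf_le ?_ hx⟩
  obtain ⟨c, hc⟩ := hb
  exact ⟨c, (hB.lowerBound_iff hs c).1 hc⟩

namespace IsSemibounded

variable {A : H →ₗ.[ℂ] H} (hA : IsSemibounded A)
include hA

theorem boundedBelow : BoundedBelow A := ⟨_, hA.lower⟩

theorem isFormApprox_of_shifted {s : ℕ → A.domain} {u : H}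
    (h1 : Tendsto (fun n => (s n : H)) atTop (𝓝 u)) {c : ℝ}
    (hc : ∀ x : A.domain, c * ‖(x : H)‖ ^ 2 ≤ (⟪(x : H), A x⟫_ℂ).re)
    (h2 : Tendsto (fun p : ℕ × ℕ => (shifted A c (s p.1 - s p.2) (s p.1 - s p.2)).re)
      atTop (𝓝 0)) : IsFormApprox A s u := by
  refine ⟨h1, ?_⟩
  have h3 : Tendsto (fun p : ℕ × ℕ => shifted A c (s p.1 - s p.2) (s p.1 - s p.2))
      atTop (𝓝 0) := by
    refine squeeze_zero_norm (fun p => ?_) h2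
    refine (norm_shifted_le hA.symm hc _ _).trans ?_
    rw [Real.mul_self_sqrt (shifted_self_nonneg hc _)]
  have h4 : Tendsto (fun p : ℕ × ℕ => ((s p.1 - s p.2 : A.domain) : H)) atTop (𝓝 0) := by
    rw [← prod_atTop_atTop_eq]
    simpa using (h1.comp tendsto_fst).sub (h1.comp tendsto_snd)
  have h5 := h3.add ((h4.inner h4).const_mul (c : ℂ))
  simp only [inner_zero_left, mul_zero, add_zero] at h5
  exact h5.congr fun p => by simp only [shifted]; ring

theorem isFormApprox_add {s t : ℕ → A.domain} {u v : H} (h : IsFormApprox A s u)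
    (k : IsFormApprox A t v) : IsFormApprox A (fun n => s n + t n) (u + v) := by
  refine hA.isFormApprox_of_shifted (h.1.add k.1) hA.lower ?_
  have h1 := ((h.cauchy (sInf (spec A))).const_mul 2).add
    ((k.cauchy (sInf (spec A))).const_mul 2)
  rw [mul_zero, add_zero] at h1
  refine squeeze_zero (fun p => shifted_self_nonneg hA.lower _) (fun p => ?_) h1
  have e := shifted_sub_self_le hA.lower (s p.1 - s p.2) (t p.2 - t p.1)
  have e2 : s p.1 + t p.1 - (s p.2 + t p.2) = s p.1 - s p.2 - (t p.2 - t p.1) := by abel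
  have e3 : shifted A (sInf (spec A)) (t p.2 - t p.1) (t p.2 - t p.1) =
      shifted A (sInf (spec A)) (t p.1 - t p.2) (t p.1 - t p.2) := by
    simp only [shifted_sub_left, shifted_sub_right]; ring
  rw [e3, ← e2] at e
  exact e

omit hA in
theorem isFormApprox_smul (r : ℂ) {s : ℕ → A.domain} {u : H} (h : IsFormApprox A s u) :
    IsFormApprox A (fun n => r • s n) (r • u) := by
  refine ⟨h.1.const_smul r, ?_⟩
  have := h.2.const_mul (starRingEnd ℂ r * r)
  rw [mul_zero] at this
  refine this.congr fun p => ?_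
  rw [← smul_sub, LinearPMap.map_smul, Submodule.coe_smul, inner_smul_left, inner_smul_right]
  ring

omit hA in
theorem isFormApprox_const (x : A.domain) : IsFormApprox A (fun _ => x) x :=
  ⟨tendsto_const_nhds, by simp⟩

/-- The form domain as a subspace. -/
def formSubmodule : Submodule ℂ H where
  carrier := formDomain A
  zero_mem' := ⟨_, isFormApprox_const 0⟩
  add_mem' := fun ⟨_, h⟩ ⟨_, k⟩ => ⟨_, hA.isFormApprox_add h k⟩
  smul_mem' := fun r _ ⟨_, h⟩ => ⟨_, isFormApprox_smul r h⟩

theorem domain_le : A.domain ≤ hA.formSubmodule := fun x hx => ⟨_, isFormApprox_const ⟨x, hx⟩⟩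

theorem isHermitianOn_form : IsHermitianOn (form A) hA.formSubmodule where
  add_left := by
    rintro u ⟨s, h⟩ v ⟨t, k⟩ w ⟨p, l⟩
    have h1 := tendsto_form hA.symm hA.boundedBelow (hA.isFormApprox_add h k) l
    have h2 := (tendsto_form hA.symm hA.boundedBelow h l).add
      (tendsto_form hA.symm hA.boundedBelow k l)
    refine tendsto_nhds_unique h1 (h2.congr fun n => ?_)
    rw [LinearPMap.map_add, inner_add_right]
  smul_left := by
    rintro r u ⟨s, h⟩ v ⟨t, k⟩
    have h1 := tendsto_form hA.symm hA.boundedBelow (isFormApprox_smul r h) k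
    have h2 := (tendsto_form hA.symm hA.boundedBelow h k).const_mul r
    refine tendsto_nhds_unique h1 (h2.congr fun n => ?_)
    rw [LinearPMap.map_smul, inner_smul_right]
  conj_symm := by
    rintro u ⟨s, h⟩ v ⟨t, k⟩
    have h1 := tendsto_form hA.symm hA.boundedBelow h k
    have h2 := (Complex.continuous_conj.tendsto _).comp
      (tendsto_form hA.symm hA.boundedBelow k h)
    refine tendsto_nhds_unique (h2.congr fun n => ?_) h1
    rw [Function.comp_apply, inner_conj_symm, hA.symm]

/-- On `Dom(A) × Dom(𝔞)` the form is `⟨A x, v⟩`. -/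
theorem form_of_mem_domain {x v : H} (hx : x ∈ A.domain) (hv : v ∈ hA.formSubmodule) :
    form A x v = ⟪v, A ⟨x, hx⟩⟫_ℂ := by
  obtain ⟨t, k⟩ := hv
  exact tendsto_nhds_unique
    (tendsto_form hA.symm hA.boundedBelow (isFormApprox_const ⟨x, hx⟩) k)
    (k.1.inner tendsto_const_nhds)

theorem lower_form {u : H} (hu : u ∈ hA.formSubmodule) :
    sInf (spec A) * ‖u‖ ^ 2 ≤ (form A u u).re := by
  obtain ⟨s, h⟩ := hu
  have h1 := (Complex.continuous_re.tendsto _).comp (tendsto_form hA.symm hA.boundedBelow h h)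
  exact le_of_tendsto_of_tendsto' ((h.1.norm.pow 2).const_mul _) h1 fun n => hA.lower (s n)

theorem formNorm_sq {u : H} (hu : u ∈ hA.formSubmodule) :
    formNorm A u ^ 2 = (form A u u).re - (sInf (spec A) - 1) * ‖u‖ ^ 2 := by
  rw [formNorm, Real.sq_sqrt]
  have := hA.lower_form hu
  nlinarith [sq_nonneg ‖u‖]

theorem norm_le_formNorm {u : H} (hu : u ∈ hA.formSubmodule) : ‖u‖ ≤ formNorm A u := by
  refine Real.le_sqrt_of_sq_le ?_
  have := hA.lower_form hu
  linarith

/-- The Cauchy–Schwarz inequality for the inner product of `H_𝔞`. -/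
theorem norm_energy_le {u v : H} (hu : u ∈ hA.formSubmodule) (hv : v ∈ hA.formSubmodule) :
    ‖form A u v - ((sInf (spec A) - 1 : ℝ) : ℂ) * ⟪v, u⟫_ℂ‖ ≤ formNorm A u * formNorm A v := by
  have hq := hA.isHermitianOn_form
  let en : hA.formSubmodule → hA.formSubmodule → ℂ := fun v u =>
    form A u v - ((sInf (spec A) - 1 : ℝ) : ℂ) * ⟪(v : H), (u : H)⟫_ℂ
  have hself : ∀ u : hA.formSubmodule, (en u u).re = formNorm A u ^ 2 := fun u => by
    rw [hA.formNorm_sq u.2, ← Complex.ofReal_re ((sInf (spec A) - 1) * ‖(u : H)‖ ^ 2),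
      ← Complex.sub_re, Complex.ofReal_mul, ← inner_self_eq_ofReal]
  let core : PreInnerProductSpace.Core ℂ hA.formSubmodule :=
    { inner := en
      conj_inner_symm := fun x y => by
        simp only [en, map_sub, map_mul, inner_conj_symm, Complex.conj_ofReal]
        rw [hq.conj_symm _ y.2 _ x.2]
      re_inner_nonneg := fun x => by
        have := hself x
        exact this.ge.trans' (sq_nonneg _)
      add_left := fun x y z => by
        simp only [en, Submodule.coe_add, inner_add_left]
        rw [hq.add_right z.2 x.2 y.2]; ring
      smul_left := fun x y r => by
        simp only [en, Submodule.coe_smul, inner_smul_left]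
        rw [hq.smul_right r y.2 x.2]; ring }
  have h := @InnerProductSpace.Core.norm_inner_le_norm ℂ hA.formSubmodule _ _ _ core ⟨v, hv⟩ ⟨u, hu⟩
  have hn : ∀ w : hA.formSubmodule, √(en w w).re = formNorm A w := fun w => by
    rw [hself]; exact Real.sqrt_sq (Real.sqrt_nonneg _)
  rw [mul_comm (formNorm A u), ← hn ⟨u, hu⟩, ← hn ⟨v, hv⟩]
  exact h

omit hA in
theorem formNorm_nonneg (u : H) : 0 ≤ formNorm A u := Real.sqrt_nonneg _

/-- The form of `A - x` is bounded on `H_𝔞`. -/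
theorem norm_form_sub_le (x : ℝ) {u v : H} (hu : u ∈ hA.formSubmodule)
    (hv : v ∈ hA.formSubmodule) :
    ‖form A u v - x * ⟪v, u⟫_ℂ‖ ≤
      (1 + |sInf (spec A) - 1 - x|) * (formNorm A u * formNorm A v) := by
  have e : form A u v - x * ⟪v, u⟫_ℂ = (form A u v - ((sInf (spec A) - 1 : ℝ) : ℂ) * ⟪v, u⟫_ℂ) +
      ((sInf (spec A) - 1 - x : ℝ) : ℂ) * ⟪v, u⟫_ℂ := by push_cast; ring
  have h1 : ‖⟪v, u⟫_ℂ‖ ≤ formNorm A u * formNorm A v := by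
    rw [mul_comm]
    exact (norm_inner_le_norm v u).trans (mul_le_mul (hA.norm_le_formNorm hv)
      (hA.norm_le_formNorm hu) (norm_nonneg _) (formNorm_nonneg _))
  rw [e, add_mul, one_mul]
  refine (norm_add_le _ _).trans (add_le_add (hA.norm_energy_le hu hv) ?_)
  rw [norm_mul, Complex.norm_real]
  exact mul_le_mul_of_nonneg_left h1 (abs_nonneg _)

theorem formNorm_add_le {u v : H} (hu : u ∈ hA.formSubmodule) (hv : v ∈ hA.formSubmodule) :
    formNorm A (u + v) ≤ formNorm A u + formNorm A v := by
  have hq := hA.isHermitianOn_form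
  have huv := hA.formSubmodule.add_mem hu hv
  refine le_of_sq_le_sq ?_ (add_nonneg (formNorm_nonneg _) (formNorm_nonneg _))
  have h1 := (Complex.re_le_norm _).trans (hA.norm_energy_le hu hv)
  have h2 := (Complex.re_le_norm _).trans (hA.norm_energy_le hv hu)
  have h3 := @norm_add_sq ℂ H _ _ _ u v
  have h4 : (⟪u, v⟫_ℂ).re = (⟪v, u⟫_ℂ).re := by
    rw [← inner_conj_symm, Complex.conj_re]
  rw [RCLike.re_eq_complex_re] at h3
  rw [Complex.sub_re, Complex.re_ofReal_mul] at h1 h2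
  rw [add_sq, hA.formNorm_sq huv, hA.formNorm_sq hu, hA.formNorm_sq hv, hq.add_left u hu v hv _ huv,
    hq.add_right hu hu hv, hq.add_right hv hu hv, h3]
  simp only [Complex.add_re]
  rw [h4] at h2 h3 ⊢
  nlinarith

theorem formNorm_smul (r : ℂ) {u : H} (hu : u ∈ hA.formSubmodule) :
    formNorm A (r • u) = ‖r‖ * formNorm A u := by
  have hq := hA.isHermitianOn_form
  have hru := hA.formSubmodule.smul_mem r hu
  have h : formNorm A (r • u) ^ 2 = (‖r‖ * formNorm A u) ^ 2 := by
    rw [mul_pow, hA.formNorm_sq hru, hA.formNorm_sq hu, hq.smul_left r u hu _ hru,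
      hq.smul_right r hu hu, norm_smul, mul_pow, ← mul_assoc, Complex.mul_conj,
      Complex.normSq_eq_norm_sq, Complex.re_ofReal_mul]
    ring
  exact (sq_eq_sq₀ (formNorm_nonneg _) (mul_nonneg (norm_nonneg _) (formNorm_nonneg _))).1 h

theorem formNorm_zero : formNorm A 0 = 0 := by
  simpa using hA.formNorm_smul 0 (hA.formSubmodule.zero_mem)

theorem formNorm_sub_rev {u v : H} (hu : u ∈ hA.formSubmodule) (hv : v ∈ hA.formSubmodule) :
    formNorm A (u - v) = formNorm A (v - u) := by
  have := hA.formNorm_smul (-1) (hA.formSubmodule.sub_mem hu hv)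
  simpa using this.symm

theorem formNorm_sub_le {u v w : H} (hu : u ∈ hA.formSubmodule) (hv : v ∈ hA.formSubmodule)
    (hw : w ∈ hA.formSubmodule) :
    formNorm A (u - w) ≤ formNorm A (u - v) + formNorm A (v - w) := by
  have := hA.formNorm_add_le (hA.formSubmodule.sub_mem hu hv) (hA.formSubmodule.sub_mem hv hw)
  simpa using this

theorem formNorm_sum_le {ι : Type*} (s : Finset ι) {f : ι → H}
    (hf : ∀ i, f i ∈ hA.formSubmodule) : formNorm A (∑ i ∈ s, f i) ≤ ∑ i ∈ s, formNorm A (f i) := by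
  classical
  induction s using Finset.induction_on with
  | empty => simp [hA.formNorm_zero]
  | insert i s hi ih =>
    rw [Finset.sum_insert hi, Finset.sum_insert hi]
    exact (hA.formNorm_add_le (hf i) (Submodule.sum_mem _ fun j _ => hf j)).trans (by gcongr)

end IsSemibounded

/-! ### Convergence of the Galerkin projections -/

theorem galerkinSubspace_le (A : H →ₗ.[ℂ] H) (K : Submodule ℂ H) (S : Set ℝ) :
    galerkinSubspace A K S ≤ K := ritzSpan_le _ _ _

instance (A : H →ₗ.[ℂ] H) (K : Submodule ℂ H) [FiniteDimensional ℂ K] (S : Set ℝ) :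
    FiniteDimensional ℂ (galerkinSubspace A K S) :=
  Submodule.finiteDimensional_of_le (galerkinSubspace_le A K S)

/-- The constant in the estimate of `IsSemibounded.formNorm_sub_orthProj_le`. -/
noncomputable def quasiOptConst (A : H →ₗ.[ℂ] H) (a b ev : ℝ) : ℝ :=
  (1 + |ev - (sInf (spec A) - 1)| / min (ev - a) (b - ev)) * (1 + |sInf (spec A) - 1 - ev|)

namespace IsSemibounded

variable {A : H →ₗ.[ℂ] H} (hA : IsSemibounded A)
include hA

variable {K : Submodule ℂ H} [FiniteDimensional ℂ K] (hK : K ≤ hA.formSubmodule) {a b : ℝ}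
include hK

/-- On the Galerkin subspaces of a bounded interval the norm of `H_𝔞` is controlled by the norm
of `H`. -/
theorem formNorm_le_of_mem_galerkinSubspace {u : H} (hu : u ∈ galerkinSubspace A K (Icc a b)) :
    formNorm A u ≤ √(b - (sInf (spec A) - 1)) * ‖u‖ := by
  have hq := hA.isHermitianOn_form.mono hK
  obtain ⟨e, μ, he⟩ := hq.exists_ritzBasis
  have huK := (galerkinSubspace_le A K _) hu
  rw [← Real.sqrt_sq (norm_nonneg u), ← Real.sqrt_mul' _ (sq_nonneg _)]
  refine Real.sqrt_le_sqrt ?_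
  have := he.form_self_le hq huK (C := b) fun i hi => by
    by_contra h
    exact hi (((he.mem_ritzSpan hq).1 hu).2 i fun h' => h h'.2)
  linarith

variable [CompleteSpace H]

/-- Let `w` be an eigenvector with eigenvalue inside `(a, b)`, and `z` an approximation of `w` in the
trial space. The part of `z` which is orthogonal to the Galerkin subspace of `[a, b]` is controlled by
the error `z - w` in `H_𝔞`. The form is tested with the image of that part under the sign of the
difference of the Galerkin operator and the eigenvalue, which turns the indefinite form
`𝔞 - ev` into a definite one. -/
theorem formNorm_sub_orthProj_le {ev : ℝ} (ha : a < ev) (hb : ev < b) {z w : H} (hz : z ∈ K)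
    (hw : w ∈ A.domain) (hwe : A ⟨w, hw⟩ = (ev : ℂ) • w) :
    formNorm A (z - orthProj (galerkinSubspace A K (Icc a b)) z) ≤
      quasiOptConst A a b ev * formNorm A (z - w) := by
  have hq := hA.isHermitianOn_form.mono hK
  obtain ⟨e, μ, he⟩ := hq.exists_ritzBasis
  set W := galerkinSubspace A K (Icc a b) with hW
  have hWK : W ≤ K := galerkinSubspace_le A K _
  set m := sInf (spec A) - 1 with hm
  set d := min (ev - a) (b - ev) with hd
  have hd0 : 0 < d := lt_min (by linarith) (by linarith)
  set x := z - orthProj W z with hx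
  have hxK : x ∈ K := K.sub_mem hz (hWK (orthProj_mem W z))
  have hxW : ∀ v ∈ ritzSpan (form A) K (Icc a b), ⟪v, x⟫_ℂ = 0 := fun v hv =>
    inner_sub_orthProj W z hv
  -- the coordinates of `x` are those of `z` outside `[a, b]`, and vanish inside
  have hcoord : ∀ i, ⟪e i, x⟫_ℂ ≠ 0 → ⟪e i, z⟫_ℂ = ⟪e i, x⟫_ℂ ∧ d ≤ |μ i - ev| := by
    intro i hi
    have h1 : μ i ∉ Icc a b := he.mem_of_orthogonal hxW hi
    have h2 := ((he.mem_ritzSpan hq).1 (orthProj_mem W z)).2 i h1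
    refine ⟨by rw [hx, inner_sub_right, h2, sub_zero], ?_⟩
    rw [mem_Icc, not_and_or, not_le, not_le] at h1
    rcases h1 with h1 | h1
    · rw [abs_of_neg (by linarith)]
      exact (min_le_left _ _).trans (by linarith)
    · rw [abs_of_pos (by linarith)]
      exact (min_le_right _ _).trans (by linarith)
  set s : Fin (Module.finrank ℂ K) → ℝ := fun i => if ev ≤ μ i then 1 else -1
  have hs1 : ∀ i, ‖(s i : ℂ)‖ = 1 := fun i => by
    simp only [s]; split_ifs <;> simp
  have hs2 : ∀ i, (μ i - ev) * s i = |μ i - ev| := fun i => by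
    simp only [s]
    split_ifs with h
    · rw [abs_of_nonneg (by linarith), mul_one]
    · rw [abs_of_neg (by linarith)]; ring
  set y := ∑ i, ((s i : ℂ) * ⟪e i, x⟫_ℂ) • e i with hy
  have hyK : y ∈ K := he.diag_mem _ _
  have hyi : ∀ i, ⟪e i, y⟫_ℂ = s i * ⟪e i, x⟫_ℂ := he.inner_diag _ _
  have hyx : formNorm A y = formNorm A x := by
    rw [formNorm, formNorm, he.form_self_re hq hyK, he.form_self_re hq hxK, he.norm_sq_eq_sum hyK,
      he.norm_sq_eq_sum hxK]
    simp only [hyi, norm_mul, hs1, one_mul]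
  have hzy : form A z y - ev * ⟪y, z⟫_ℂ = ((∑ i, |μ i - ev| * ‖⟪e i, x⟫_ℂ‖ ^ 2 : ℝ) : ℂ) := by
    rw [he.form_eq_sum hq hz hyK, he.inner_eq_sum hz, Finset.mul_sum, ← Finset.sum_sub_distrib,
      Complex.ofReal_sum]
    refine Finset.sum_congr rfl fun i _ => ?_
    rw [← inner_conj_symm y, hyi, map_mul, Complex.conj_ofReal]
    by_cases hi : ⟪e i, x⟫_ℂ = 0
    · simp [hi]
    · rw [(hcoord i hi).1, ← hs2, ← Complex.normSq_eq_norm_sq]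
      push_cast
      rw [Complex.normSq_eq_conj_mul_self]
      ring
  have hlow : formNorm A x ^ 2 ≤
      (1 + |ev - m| / d) * ∑ i, |μ i - ev| * ‖⟪e i, x⟫_ℂ‖ ^ 2 := by
    rw [hA.formNorm_sq (hK hxK), he.form_self_re hq hxK, he.norm_sq_eq_sum hxK, Finset.mul_sum,
      ← Finset.sum_sub_distrib, Finset.mul_sum]
    refine Finset.sum_le_sum fun i _ => ?_
    by_cases hi : ⟪e i, x⟫_ℂ = 0
    · simp [hi]
    · have h1 := (hcoord i hi).2
      have h2 : |ev - m| ≤ |ev - m| / d * |μ i - ev| := by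
        rw [div_mul_eq_mul_div, le_div_iff₀ hd0]
        gcongr
      rw [← sub_mul, ← mul_assoc]
      refine mul_le_mul_of_nonneg_right ?_ (sq_nonneg _)
      have := le_abs_self (μ i - ev)
      have := le_abs_self (ev - m)
      linarith
  have hwD : w ∈ hA.formSubmodule := hA.domain_le hw
  have hwy : form A w y - ev * ⟪y, w⟫_ℂ = 0 := by
    rw [hA.form_of_mem_domain hw (hK hyK), hwe, inner_smul_right, sub_self]
  have hup : ∑ i, |μ i - ev| * ‖⟪e i, x⟫_ℂ‖ ^ 2 ≤
      (1 + |m - ev|) * (formNorm A (z - w) * formNorm A x) := by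
    have h1 : form A (z - w) y - ev * ⟪y, z - w⟫_ℂ =
        ((∑ i, |μ i - ev| * ‖⟪e i, x⟫_ℂ‖ ^ 2 : ℝ) : ℂ) := by
      rw [hA.isHermitianOn_form.sub_left (hK hz) hwD (hK hyK), inner_sub_right, ← hzy]
      linear_combination -hwy
    have h2 := hA.norm_form_sub_le ev (hA.formSubmodule.sub_mem (hK hz) hwD) (hK hyK)
    rw [h1, Complex.norm_real, hyx] at h2
    exact (le_abs_self _).trans h2
  have hfin : formNorm A x * formNorm A x ≤
      quasiOptConst A a b ev * formNorm A (z - w) * formNorm A x := by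
    calc formNorm A x * formNorm A x = formNorm A x ^ 2 := (sq _).symm
      _ ≤ _ := hlow
      _ ≤ (1 + |ev - m| / d) * ((1 + |m - ev|) * (formNorm A (z - w) * formNorm A x)) := by
        gcongr
      _ = _ := by rw [quasiOptConst]; ring
  rcases (formNorm_nonneg (A := A) x).eq_or_lt with h | h
  · rw [← h]
    refine mul_nonneg ?_ (formNorm_nonneg _)
    rw [quasiOptConst]
    positivity
  · exact le_of_mul_le_mul_right hfin h

/-- The Galerkin projection of `A p - c p`, where `c` is the midpoint of `[a, b]`, is smaller by the
factor `(b - a) / 2` than that of `p`, up to the distance of `p` from the trial space. -/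
theorem norm_orthProj_le_of_resolvent (hab : a ≤ b) {z p f : H} (hz : z ∈ K) (hp : p ∈ A.domain)
    (hf : A ⟨p, hp⟩ - (((a + b) / 2 : ℝ) : ℂ) • p = f) :
    ‖orthProj (galerkinSubspace A K (Icc a b)) f‖ ≤
      (b - a) / 2 * ‖orthProj (galerkinSubspace A K (Icc a b)) p‖ +
        ((b - a) / 2 + (1 + |sInf (spec A) - 1 - (a + b) / 2|) *
          √(b - (sInf (spec A) - 1))) * formNorm A (p - z) := by
  have hq := hA.isHermitianOn_form.mono hK
  have hqD := hA.isHermitianOn_form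
  obtain ⟨e, μ, he⟩ := hq.exists_ritzBasis
  set W := galerkinSubspace A K (Icc a b) with hW
  have hWK : W ≤ K := galerkinSubspace_le A K _
  set C := √(b - (sInf (spec A) - 1))
  set C' := 1 + |sInf (spec A) - 1 - (a + b) / 2|
  set c := (a + b) / 2 with hc
  set r := (b - a) / 2 with hr
  have hr0 : 0 ≤ r := by rw [hr]; linarith
  set v := orthProj W f with hv
  have hvW : v ∈ W := orthProj_mem W f
  have hvK := hWK hvW
  have hpD := hA.domain_le hp
  have hQz := orthProj_mem W z
  have hpz := hA.formSubmodule.sub_mem hpD (hK hz)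
  have h1 : ⟪v, f⟫_ℂ = (form A (p - z) v - c * ⟪v, p - z⟫_ℂ) +
      (form A (orthProj W z) v - c * ⟪v, orthProj W z⟫_ℂ) := by
    have e1 : form A (z - orthProj W z) v = 0 :=
      he.form_eq_zero_of_orthogonal hq (K.sub_mem hz (hWK hQz))
        (fun w hw => inner_sub_orthProj W z hw) hvW
    rw [hq.sub_left hz (hWK hQz) hvK] at e1
    rw [← hf, inner_sub_right, ← hA.form_of_mem_domain hp (hK hvK), inner_smul_right,
      hqD.sub_left hpD (hK hz) (hK hvK), inner_sub_right, inner_orthProj_right W z hvW]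
    linear_combination e1
  have h2 := hA.norm_form_sub_le c hpz (hK hvK)
  have h3 := he.norm_form_sub_le hq (hWK hQz) hvK hr0 (c := c) fun i hi => by
    have h : μ i ∈ Icc a b := by
      by_contra h
      exact hi (((he.mem_ritzSpan hq).1 hQz).2 i h)
    rw [abs_le, hc, hr]
    constructor <;> linarith [h.1, h.2]
  have h4 : ‖orthProj W z‖ ≤ ‖orthProj W p‖ + formNorm A (p - z) := by
    have : orthProj W z = orthProj W p - orthProj W (p - z) := by rw [map_sub]; abel
    rw [this]
    refine (norm_sub_le _ _).trans ?_
    gcongr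
    exact (norm_orthProj_le W _).trans (hA.norm_le_formNorm hpz)
  have h5 := hA.formNorm_le_of_mem_galerkinSubspace hK hvW
  have h6 : ‖⟪v, f⟫_ℂ‖ = ‖v‖ * ‖v‖ := by
    rw [← inner_orthProj_right W f hvW, ← hv, inner_self_eq_norm_sq_to_K, norm_pow, sq]
    simp
  have hN := formNorm_nonneg (A := A) (p - z)
  have h7 : ‖v‖ * ‖v‖ ≤ (r * ‖orthProj W p‖ + (r + C' * C) * formNorm A (p - z)) * ‖v‖ := by
    rw [← h6, h1]
    calc _ ≤ C' * (formNorm A (p - z) * formNorm A v) + r * ‖orthProj W z‖ * ‖v‖ :=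
          (norm_add_le _ _).trans (add_le_add h2 h3)
      _ ≤ C' * (formNorm A (p - z) * (C * ‖v‖)) +
          r * (‖orthProj W p‖ + formNorm A (p - z)) * ‖v‖ := by gcongr
      _ = _ := by ring
  rcases (norm_nonneg v).eq_or_lt with h | h
  · rw [← h]; positivity
  · exact le_of_mul_le_mul_right h7 h

end IsSemibounded

section Convergence

variable [CompleteSpace H] {A : H →ₗ.[ℂ] H} (hA : IsSemibounded A) {L : ℕ → Submodule ℂ H}
  (hL : IsTrialSequence A L) {a b ev : ℝ}
include hA hL

/-- The Galerkin projections converge on eigenvectors in the norm of `H_𝔞`. -/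
theorem tendsto_orthProj_eigenvector (ha : a < ev) (hb : ev < b) {w : H} (hw : w ∈ A.domain)
    (hwe : A ⟨w, hw⟩ = (ev : ℂ) • w) :
    Tendsto (fun n => formNorm A (orthProj (galerkinSubspace A (L n) (Icc a b)) w - w)) atTop
      (𝓝 0) := by
  obtain ⟨s, hs, hs'⟩ := hL.approx w (hA.domain_le hw)
  have hLD : ∀ n, L n ≤ hA.formSubmodule := hL.subset
  have hwD := hA.domain_le hw
  have h0 := hs'.const_mul (√(b - (sInf (spec A) - 1)) + quasiOptConst A a b ev + 1)
  rw [mul_zero] at h0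
  refine squeeze_zero (fun _ => IsSemibounded.formNorm_nonneg _) (fun n => ?_) h0
  have := hL.finite n
  set W := galerkinSubspace A (L n) (Icc a b)
  have hWD : W ≤ hA.formSubmodule := (galerkinSubspace_le A _ _).trans (hLD n)
  have hQ : ∀ u, orthProj W u ∈ hA.formSubmodule := fun u => hWD (orthProj_mem W u)
  have hsD := hLD n (hs n)
  have hws := hA.formSubmodule.sub_mem hwD hsD
  have e1 : orthProj W w - w =
      orthProj W (w - s n) + ((orthProj W (s n) - s n) + (s n - w)) := by
    rw [map_sub]; abel
  have h1 := hA.formNorm_le_of_mem_galerkinSubspace (hLD n) (orthProj_mem W (w - s n))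
  have h2 := hA.formNorm_sub_orthProj_le (hLD n) ha hb (hs n) hw hwe
  have h3 := (norm_orthProj_le W (w - s n)).trans (hA.norm_le_formNorm hws)
  rw [hA.formNorm_sub_rev hsD (hQ _), hA.formNorm_sub_rev hsD hwD] at h2
  rw [e1, add_mul, add_mul, one_mul, add_assoc]
  refine (hA.formNorm_add_le (hQ _) (hA.formSubmodule.add_mem
    (hA.formSubmodule.sub_mem (hQ _) hsD) (hA.formSubmodule.sub_mem hsD hwD))).trans ?_
  refine add_le_add (h1.trans (by gcongr)) ((hA.formNorm_add_le
    (hA.formSubmodule.sub_mem (hQ _) hsD) (hA.formSubmodule.sub_mem hsD hwD)).trans ?_)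
  rw [hA.formNorm_sub_rev hsD hwD]
  gcongr

/-- Spurious Galerkin vectors are asymptotically orthogonal to every vector: if the spectrum of `A`
on the range of `1 - E` has distance more than `(b - a) / 2` from the midpoint `c` of `[a, b]`, then
`orthProj Wₙ (w - E w) → 0`. Each application of the inverse `S` of `A - c` gains a factor
`(b - a) / 2 * ‖S‖ < 1`. -/
theorem tendsto_orthProj_compl (hab : a ≤ b) {E S : H →L[ℂ] H} (hES : ∀ w, E (S w) = 0)
    (hS : ∀ w, ∃ h : S w ∈ A.domain,
      A ⟨S w, h⟩ - (((a + b) / 2 : ℝ) : ℂ) • S w = w - E w)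
    (hr : (b - a) / 2 * ‖S‖ < 1) (w : H) :
    Tendsto (fun n => ‖orthProj (galerkinSubspace A (L n) (Icc a b)) (w - E w)‖) atTop (𝓝 0) := by
  have hLD : ∀ n, L n ≤ hA.formSubmodule := hL.subset
  set r := (b - a) / 2 with hr'
  have hr0 : 0 ≤ r := by rw [hr']; linarith
  set Q := fun n => orthProj (galerkinSubspace A (L n) (Icc a b))
  set C := r + (1 + |sInf (spec A) - 1 - (a + b) / 2|) * √(b - (sInf (spec A) - 1))
  set q := r * ‖S‖ with hq
  have hstep : ∀ w : H, ∀ ε > 0, ∀ᶠ n in atTop, ‖Q n (w - E w)‖ ≤ r * ‖Q n (S w)‖ + ε := by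
    intro w ε hε
    obtain ⟨h, h'⟩ := hS w
    obtain ⟨s, hs, hs'⟩ := hL.approx _ (hA.domain_le h)
    have h0 := hs'.const_mul C
    rw [mul_zero] at h0
    filter_upwards [h0.eventually (gt_mem_nhds hε)] with n hn
    have := hL.finite n
    exact (hA.norm_orthProj_le_of_resolvent (hLD n) hab (hs n) h h').trans (by gcongr)
  have hiter : ∀ (k : ℕ) (w : H), ∀ ε > 0, ∀ᶠ n in atTop,
      ‖Q n (w - E w)‖ ≤ q ^ k * ((1 + ‖E‖) * ‖w‖) + ε := by
    intro k
    induction k with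
    | zero =>
      intro w ε hε
      refine Eventually.of_forall fun n => ?_
      have := hL.finite n
      have h1 := norm_sub_le w (E w)
      have h2 := E.le_opNorm w
      rw [pow_zero, one_mul]
      exact (norm_orthProj_le _ _).trans (by linarith)
    | succ k ih =>
      intro w ε hε
      filter_upwards [hstep w (ε / 2) (by positivity), ih (S w) (ε / 2 / (r + 1)) (by positivity)]
        with n h1 h2
      rw [hES, sub_zero] at h2
      have h3 := S.le_opNorm w
      calc ‖Q n (w - E w)‖ ≤ r * ‖Q n (S w)‖ + ε / 2 := h1
        _ ≤ r * (q ^ k * ((1 + ‖E‖) * (‖S‖ * ‖w‖)) + ε / 2 / (r + 1)) + ε / 2 := by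
          gcongr
          exact h2.trans (by gcongr)
        _ = q ^ (k + 1) * ((1 + ‖E‖) * ‖w‖) + (r / (r + 1)) * (ε / 2) + ε / 2 := by
          rw [hq]; field_simp; ring
        _ ≤ q ^ (k + 1) * ((1 + ‖E‖) * ‖w‖) + 1 * (ε / 2) + ε / 2 := by
          gcongr
          rw [div_le_one (by positivity)]; linarith
        _ = _ := by ring
  refine (shifted_small_iff fun _ => norm_nonneg _).2 fun ε hε => ?_
  have hlim : Tendsto (fun k : ℕ => q ^ k * ((1 + ‖E‖) * ‖w‖)) atTop (𝓝 0) := by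
    simpa using (tendsto_pow_atTop_nhds_zero_of_lt_one (by positivity) hr).mul_const
      ((1 + ‖E‖) * ‖w‖)
  obtain ⟨k, hk⟩ := (hlim.eventually (gt_mem_nhds (half_pos hε))).exists
  filter_upwards [hiter k w (ε / 2) (half_pos hε)] with n hn
  change ‖Q n (w - E w)‖ ≤ ε
  linarith

/-- The Galerkin projections converge strongly to the spectral projection, as operators from `H`
to `H_𝔞`. -/
theorem tendsto_formNorm_orthProj_sub (ha : a < ev) (hb : ev < b) {E S : H →L[ℂ] H}
    (hE : ∀ u, ∃ h : E u ∈ A.domain, A ⟨E u, h⟩ = (ev : ℂ) • E u) (hES : ∀ w, E (S w) = 0)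
    (hS : ∀ w, ∃ h : S w ∈ A.domain,
      A ⟨S w, h⟩ - (((a + b) / 2 : ℝ) : ℂ) • S w = w - E w)
    (hr : (b - a) / 2 * ‖S‖ < 1) (u : H) :
    Tendsto (fun n => formNorm A (orthProj (galerkinSubspace A (L n) (Icc a b)) u - E u)) atTop
      (𝓝 0) := by
  obtain ⟨h, h'⟩ := hE u
  have h1 := tendsto_orthProj_eigenvector hA hL ha hb h h'
  have h2 := (tendsto_orthProj_compl hA hL (ha.trans hb).le hES hS hr u).const_mul
    (√(b - (sInf (spec A) - 1)))
  have h3 := h2.add h1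
  rw [mul_zero, add_zero] at h3
  have hLD : ∀ n, L n ≤ hA.formSubmodule := hL.subset
  refine squeeze_zero (fun _ => IsSemibounded.formNorm_nonneg _) (fun n => ?_) h3
  have := hL.finite n
  set W := galerkinSubspace A (L n) (Icc a b)
  have hQ : ∀ u, orthProj W u ∈ hA.formSubmodule := fun u =>
    hLD n (galerkinSubspace_le A _ _ (orthProj_mem W u))
  have e1 : orthProj W u - E u = orthProj W (u - E u) + (orthProj W (E u) - E u) := by
    rw [map_sub]; abel
  rw [e1]
  exact (hA.formNorm_add_le (hQ _) (hA.formSubmodule.sub_mem (hQ _) (hA.domain_le h))).trans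
    (add_le_add (hA.formNorm_le_of_mem_galerkinSubspace (hLD n) (orthProj_mem W _)) le_rfl)

end Convergence

/-! ### Compressions of a projection -/

section Compression

variable [CompleteSpace H]

/-- The form `⟨P u, v⟩` of the orthogonal projection `P` onto `K`. Its Ritz vectors on a subspace `W`
are the eigenvectors of the compression of `P` to `W`. -/
noncomputable def projForm (K : Submodule ℂ H) (u v : H) : ℂ := ⟪v, orthProj K u⟫_ℂ

variable (K : Submodule ℂ H) [FiniteDimensional ℂ K]

theorem isHermitianOn_projForm (D : Submodule ℂ H) : IsHermitianOn (projForm K) D where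
  add_left u _ v _ w _ := by simp only [projForm, map_add, inner_add_right]
  smul_left r u _ v _ := by simp only [projForm, map_smul, inner_smul_right]
  conj_symm u _ v _ := by
    simp only [projForm]
    rw [inner_conj_symm, inner_orthProj_left]

theorem projForm_self (u : H) : projForm K u u = ((‖orthProj K u‖ ^ 2 : ℝ) : ℂ) := by
  rw [projForm, ← inner_self_eq_ofReal, inner_orthProj_left, orthProj_eq_self K (orthProj_mem K u)]

theorem IsRitzBasis.mem_Icc {K : Submodule ℂ H} [FiniteDimensional ℂ K] {V : Submodule ℂ H}
    {ι : Type*} [Fintype ι] {e : ι → H} {μ : ι → ℝ} (he : IsRitzBasis (projForm K) V e μ) (i : ι) :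
    μ i ∈ Icc (0 : ℝ) 1 := by
  have h1 := he.form_left i _ (he.mem i)
  have h2 : ⟪e i, e i⟫_ℂ = 1 := by
    rw [inner_self_eq_norm_sq_to_K, he.orthonormal.1 i]; simp
  rw [h2, mul_one, projForm_self, Complex.ofReal_inj] at h1
  have h3 := norm_orthProj_le K (e i)
  rw [he.orthonormal.1 i] at h3
  rw [← h1]
  exact ⟨by positivity, pow_le_one₀ (norm_nonneg _) h3⟩

omit [FiniteDimensional ℂ K] in
theorem orthProj_orthProj_eq_smul_iff {W : Submodule ℂ H} [FiniteDimensional ℂ W] {u : H}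
    (hu : u ∈ W) (x : ℂ) :
    orthProj W (orthProj K u) = x • u ↔ ∀ v ∈ W, projForm K u v = x * ⟪v, u⟫_ℂ := by
  constructor
  · intro h v hv
    rw [projForm, ← inner_orthProj_right W _ hv, h, inner_smul_right]
  · intro h
    refine eq_orthProj W (W.smul_mem _ hu) fun w hw => ?_
    rw [inner_sub_right, inner_smul_right, ← h w hw, projForm, sub_self]

omit [FiniteDimensional ℂ K] in
theorem spectralSubspace_compression (W : Submodule ℂ H) [FiniteDimensional ℂ W] (S : Set ℝ) :
    spectralSubspace (compression K W) S = ritzSpan (projForm K) W S := by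
  unfold spectralSubspace ritzSpan
  congr 1
  ext u
  refine exists_congr fun μ => and_congr_right fun _ => ?_
  constructor
  · rintro ⟨h, h'⟩
    exact ⟨h, (orthProj_orthProj_eq_smul_iff K (W := W) h _).1 h'⟩
  · rintro ⟨h, h'⟩
    exact ⟨h, (orthProj_orthProj_eq_smul_iff K (W := W) h _).2 h'⟩

variable (V : Submodule ℂ H) [FiniteDimensional ℂ V]

omit [FiniteDimensional ℂ K] in
theorem spectralSubspace_sandwich {S : Set ℝ} (hS : 0 ∉ S) :
    spectralSubspace (ofBounded (orthProj V ∘L orthProj K ∘L orthProj V)) S =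
      ritzSpan (projForm K) V S := by
  unfold spectralSubspace ritzSpan
  congr 1
  ext u
  refine exists_congr fun μ => and_congr_right fun hμ => ?_
  have hμ0 : (μ : ℂ) ≠ 0 := by
    rintro h
    rw [Complex.ofReal_eq_zero] at h
    exact hS (h ▸ hμ)
  constructor
  · rintro ⟨h, h'⟩
    have h' : orthProj V (orthProj K (orthProj V u)) = (μ : ℂ) • u := h'
    have huV : u ∈ V := by
      have := V.smul_mem (μ : ℂ)⁻¹ (orthProj_mem V (orthProj K (orthProj V u)))
      rwa [h', smul_smul, inv_mul_cancel₀ hμ0, one_smul] at this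
    rw [orthProj_eq_self V huV] at h'
    exact ⟨huV, (orthProj_orthProj_eq_smul_iff K huV _).1 h'⟩
  · rintro ⟨h, h'⟩
    refine ⟨Submodule.mem_top, ?_⟩
    change orthProj V (orthProj K (orthProj V u)) = (μ : ℂ) • u
    rw [orthProj_eq_self V h]
    exact (orthProj_orthProj_eq_smul_iff K h _).2 h'

variable {K V} {ι : Type*} [Fintype ι] {e : ι → H} {μ : ι → ℝ}

omit [CompleteSpace H] [FiniteDimensional ℂ V] in
theorem IsRitzBasis.exists_of_ne_zero {q : H → H → ℂ} (he : IsRitzBasis q V e μ)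
    (hq : IsHermitianOn q V) {S : Set ℝ} {u : H} (hu : u ∈ ritzSpan q V S) (h0 : u ≠ 0) :
    ∃ i, μ i ∈ S := by
  by_contra! h
  obtain ⟨h1, h2⟩ := (he.mem_ritzSpan hq).1 hu
  refine h0 ?_
  rw [← he.sum_repr u h1]
  exact Finset.sum_eq_zero fun i _ => by rw [h2 i (h i), zero_smul]

omit [CompleteSpace H] in
/-- The spectrum of a bounded operator, considered as an unbounded one, consists of points of its
spectrum in the algebra of bounded operators. -/
theorem mem_spectrum_of_mem_spec_ofBounded {T : H →L[ℂ] H} {x : ℝ} (hx : x ∈ spec (ofBounded T)) :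
    (x : ℂ) ∈ spectrum ℂ T := by
  intro h
  obtain ⟨G, hG1, hG2⟩ := isUnit_iff_exists.1 h
  refine hx ⟨-G, fun u => ⟨Submodule.mem_top, ?_⟩, fun u => ?_⟩
  · have := congrArg (fun R : H →L[ℂ] H => R u) hG1
    simp only [mul_apply_eq_comp, sub_apply, Algebra.algebraMap_eq_smul_one, smul_apply,
      one_apply_eq_self] at this
    change T ((-G) u) - (x : ℂ) • (-G) u = u
    rw [neg_apply, map_neg, smul_neg, sub_neg_eq_add, neg_add_eq_sub]
    exact this
  · have := congrArg (fun R : H →L[ℂ] H => R (u : H)) hG2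
    simp only [mul_apply_eq_comp, sub_apply, Algebra.algebraMap_eq_smul_one, smul_apply,
      one_apply_eq_self] at this
    change (-G) (T (u : H) - (x : ℂ) • (u : H)) = u
    rw [neg_apply, ← map_neg, neg_sub]
    exact this

theorem isCompactOperator_orthProj (V : Submodule ℂ H) [FiniteDimensional ℂ V] :
    IsCompactOperator (orthProj V) := by
  rw [orthProj_eq_starProjection]
  have h : IsCompactOperator (id : V → V) := by
    exact (isCompactOperator_id_iff_finiteDimensional (𝕜 := ℂ)).2 inferInstance
  exact (h.comp_clm V.orthogonalProjectionOnto).clm_comp V.subtypeL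

/-- The non-zero spectrum of `E P E` consists of the non-zero Ritz values of `P` on the range
of `E`. -/
theorem exists_eq_of_mem_spec_sandwich (he : IsRitzBasis (projForm K) V e μ) {x : ℝ}
    (hx : x ∈ spec (ofBounded (orthProj V ∘L orthProj K ∘L orthProj V))) (hx0 : x ≠ 0) :
    ∃ i, μ i = x := by
  have hT : IsCompactOperator (orthProj V ∘L orthProj K ∘L orthProj V) :=
    (isCompactOperator_orthProj V).comp_clm _
  obtain ⟨u, hu⟩ := ((hT.hasEigenvalue_iff_mem_spectrum (by exact_mod_cast hx0)).2
    (mem_spectrum_of_mem_spec_ofBounded hx)).exists_hasEigenvector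
  have h1 : u ∈ spectralSubspace (ofBounded (orthProj V ∘L orthProj K ∘L orthProj V)) {x} :=
    Submodule.subset_span ⟨x, rfl, Submodule.mem_top, hu.apply_eq_smul⟩
  rw [spectralSubspace_sandwich K V (by simpa using hx0.symm)] at h1
  exact he.exists_of_ne_zero (isHermitianOn_projForm K V) h1 hu.2

/-- On an infinite-dimensional space the discrete spectrum of `E P E` consists of the non-zero Ritz
values of `P` on the range of `E`: zero is an eigenvalue of infinite multiplicity. -/
theorem mem_discSpec_sandwich_iff (hH : ¬ FiniteDimensional ℂ H)
    (he : IsRitzBasis (projForm K) V e μ) {x : ℝ} :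
    x ∈ discSpec (ofBounded (orthProj V ∘L orthProj K ∘L orthProj V)) ↔
      x ≠ 0 ∧ ∃ i, μ i = x := by
  set T := orthProj V ∘L orthProj K ∘L orthProj V with hT
  constructor
  · rintro ⟨h1, -, -, h4⟩
    have hx0 : x ≠ 0 := by
      rintro rfl
      refine hH ?_
      have h5 : V ⊔ spectralSubspace (ofBounded T) {0} = ⊤ := by
        refine eq_top_iff.2 fun u _ => ?_
        rw [← add_sub_cancel (orthProj V u) u]
        refine Submodule.add_mem_sup (orthProj_mem V u)
          (Submodule.subset_span ⟨0, rfl, Submodule.mem_top, ?_⟩)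
        change T (u - orthProj V u) = _
        have : orthProj V (u - orthProj V u) = 0 := by
          rw [map_sub, orthProj_eq_self V (orthProj_mem V u), sub_self]
        simp [hT, this]
      have h6 : FiniteDimensional ℂ (V ⊔ spectralSubspace (ofBounded T) {0} : Submodule ℂ H) :=
        inferInstance
      rw [h5] at h6
      exact (Submodule.topEquiv (R := ℂ) (M := H)).finiteDimensional
    exact ⟨hx0, exists_eq_of_mem_spec_sandwich he h1 hx0⟩
  · rintro ⟨hx0, i, rfl⟩
    have hq := isHermitianOn_projForm K V
    have hsub := spectralSubspace_sandwich K V (S := {μ i}) (by simpa using hx0.symm)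
    have hei : e i ≠ 0 := he.orthonormal.ne_zero i
    have hTe : T (e i) = (μ i : ℂ) • e i := by
      simp only [hT, ContinuousLinearMap.comp_apply]
      rw [orthProj_eq_self V (he.mem i)]
      exact (orthProj_orthProj_eq_smul_iff K (he.mem i) _).2 (he.form_left i)
    refine ⟨mem_spec_of_eigenvector hei (A := ofBounded T) Submodule.mem_top hTe, ?_, ?_, ?_⟩
    · have hfin : ((insert 0 (range μ)) \ {μ i} : Set ℝ).Finite :=
        ((finite_range μ).insert 0).sdiff
      obtain ⟨ε, hε, h⟩ := Metric.isOpen_iff.1 hfin.isClosed.isOpen_compl (μ i) (by simp)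
      refine ⟨ε, hε, fun y hy hyε => ?_⟩
      have h1 := h (show y ∈ Metric.ball (μ i) ε by rwa [Metric.mem_ball, Real.dist_eq])
      by_contra hne
      refine h1 ⟨?_, hne⟩
      by_cases hy0 : y = 0
      · exact Or.inl hy0
      · exact Or.inr (exists_eq_of_mem_spec_sandwich he hy hy0)
    · rw [hsub]
      intro hbot
      have := he.basis_mem_ritzSpan (S := {μ i}) rfl
      rw [hbot] at this
      exact hei ((Submodule.mem_bot ℂ).1 this)
    · rw [hsub]
      exact Submodule.finiteDimensional_of_le (ritzSpan_le _ _ _)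

instance (q : H → H → ℂ) (V : Submodule ℂ H) [FiniteDimensional ℂ V] (S : Set ℝ) :
    FiniteDimensional ℂ (ritzSpan q V S) :=
  Submodule.finiteDimensional_of_le (ritzSpan_le q V S)

omit [FiniteDimensional ℂ V] in
theorem orthProj_eq_zero_of_coord (he : IsRitzBasis (projForm K) V e μ) {y : H} (hy : y ∈ V)
    (h : ∀ i, ⟪e i, y⟫_ℂ ≠ 0 → μ i = 0) : orthProj K y = 0 := by
  have h1 := he.form_self_le (isHermitianOn_projForm K V) hy (C := 0) fun i hi => (h i hi).le
  rw [projForm_self, Complex.ofReal_re, zero_mul] at h1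
  have h2 := le_antisymm h1 (sq_nonneg _)
  exact norm_eq_zero.1 (pow_eq_zero_iff two_ne_zero |>.1 h2)

theorem exists_ritzValue_ne_zero (he : IsRitzBasis (projForm K) V e μ)
    (h : Module.finrank ℂ (orthProj K ∘L orthProj V).range ≠ 0) : ∃ i, μ i ≠ 0 := by
  by_contra! hcon
  refine h ?_
  have h1 : orthProj K ∘L orthProj V = 0 := by
    ext u
    exact orthProj_eq_zero_of_coord he (orthProj_mem V u) fun i _ => hcon i
  rw [h1, ContinuousLinearMap.toLinearMap_zero, LinearMap.range_zero]
  exact finrank_bot ℂ H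

/-- `P` maps the span of the Ritz vectors with non-zero Ritz values bijectively onto the range
of `P E`. -/
theorem finrank_ritzSpan_projForm (he : IsRitzBasis (projForm K) V e μ) {γ : ℝ} (hγ : 0 < γ)
    (hμ : ∀ i, μ i ≠ 0 → γ ≤ μ i) :
    Module.finrank ℂ (ritzSpan (projForm K) V (Icc γ 1)) =
      Module.finrank ℂ (orthProj K ∘L orthProj V).range := by
  have hq := isHermitianOn_projForm K V
  set M := ritzSpan (projForm K) V (Icc γ 1) with hM
  have hMV : M ≤ V := ritzSpan_le _ _ _
  set f : M →ₗ[ℂ] H := (orthProj K : H →ₗ[ℂ] H).domRestrict M with hf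
  have hinj : Function.Injective f := by
    refine (injective_iff_map_eq_zero f).2 fun u hu => ?_
    have hu : orthProj K (u : H) = 0 := hu
    obtain ⟨h1, h2⟩ := (he.mem_ritzSpan hq).1 u.2
    refine Subtype.ext ?_
    rw [← he.sum_repr _ h1]
    refine Finset.sum_eq_zero fun i _ => ?_
    by_cases hi : μ i ∈ Icc γ 1
    · have h3 : projForm K (e i) u = 0 := by
        rw [projForm, ← inner_orthProj_left, hu, inner_zero_left]
      rw [he.form_left i u h1, mul_eq_zero, Complex.ofReal_eq_zero] at h3
      have h4 := h3.resolve_left (hγ.trans_le hi.1).ne'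
      rw [← inner_conj_symm, h4, map_zero, zero_smul]
    · rw [h2 i hi, zero_smul]
  have hrange : LinearMap.range f = (orthProj K ∘L orthProj V).range := by
    apply le_antisymm
    · rintro _ ⟨u, rfl⟩
      refine ⟨u, ?_⟩
      change orthProj K (orthProj V u) = orthProj K (u : H)
      rw [orthProj_eq_self V (hMV u.2)]
    · rintro _ ⟨u, rfl⟩
      refine ⟨⟨orthProj M (orthProj V u), orthProj_mem M _⟩, ?_⟩
      change orthProj K (orthProj M (orthProj V u)) = orthProj K (orthProj V u)
      rw [eq_comm, ← sub_eq_zero, ← map_sub]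
      refine orthProj_eq_zero_of_coord he
        (V.sub_mem (orthProj_mem V u) (hMV (orthProj_mem M _))) fun i hi => ?_
      by_contra h0
      exact he.mem_of_orthogonal (fun w hw => inner_sub_orthProj M _ hw) hi
        ⟨hμ i h0, (he.mem_Icc i).2⟩
  rw [← hrange, LinearMap.finrank_range_of_inj hinj]

/-! ### Perturbation of the spectral subspaces of the compressions -/

variable (K)

/-- An approximate eigenvector `u` of the compression of `P` to `W`, with approximate eigenvalue `x`
above `s`, has a small component in `W` orthogonal to the Ritz vectors with Ritz values in
`[s, 1]`. -/
theorem norm_orthProj_sub_ritz_le (W : Submodule ℂ H) [FiniteDimensional ℂ W] (s x : ℝ) (u : H) :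
    (x - s) * ‖orthProj W u - orthProj (ritzSpan (projForm K) W (Icc s 1)) u‖ ≤
      ‖(x : ℂ) • u - orthProj W (orthProj K (orthProj W u))‖ := by
  have hq := isHermitianOn_projForm K W
  obtain ⟨e, μ, he⟩ := hq.exists_ritzBasis
  set F := ritzSpan (projForm K) W (Icc s 1)
  have hFW : F ≤ W := ritzSpan_le _ _ _
  set y := orthProj W u - orthProj F u with hy
  have hyW : y ∈ W := W.sub_mem (orthProj_mem W u) (hFW (orthProj_mem F u))
  have hyF : ∀ w ∈ F, ⟪w, y⟫_ℂ = 0 := fun w hw => by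
    rw [hy, inner_sub_right, inner_orthProj_right W u (hFW hw), inner_orthProj_right F u hw, sub_self]
  have h1 : (projForm K y y).re ≤ s * ‖y‖ ^ 2 := by
    refine he.form_self_le hq hyW fun i hi => ?_
    have h2 := he.mem_of_orthogonal hyF hi
    by_contra! h3
    exact h2 ⟨h3.le, (he.mem_Icc i).2⟩
  have h2 : ⟪y, (x : ℂ) • u - orthProj W (orthProj K (orthProj W u))⟫_ℂ =
      ((x * ‖y‖ ^ 2 : ℝ) : ℂ) - projForm K y y := by
    have e1 : ⟪y, u⟫_ℂ = ⟪y, y⟫_ℂ := by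
      have : ⟪y, orthProj F u⟫_ℂ = 0 := by
        rw [← inner_conj_symm, hyF _ (orthProj_mem F u), map_zero]
      rw [← inner_orthProj_right W u hyW]
      conv_rhs => rw [hy, inner_sub_right, ← hy, this, sub_zero]
    have e2 : projForm K (orthProj F u) y = 0 := by
      rw [← hq.conj_symm _ (hFW (orthProj_mem F u)) _ hyW,
        he.form_eq_zero_of_orthogonal hq hyW hyF (orthProj_mem F u), map_zero]
    have e3 : projForm K (orthProj W u) y = projForm K y y := by
      have := hq.sub_left (orthProj_mem W u) (hFW (orthProj_mem F u)) hyW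
      rw [e2, sub_zero, ← hy] at this
      exact this.symm
    rw [inner_sub_right, inner_smul_right, inner_orthProj_right W _ hyW, e1, inner_self_eq_ofReal, ← e3, projForm,
      ← Complex.ofReal_mul]
  have h3 := (Complex.re_le_norm _).trans (norm_inner_le_norm (𝕜 := ℂ) y
    ((x : ℂ) • u - orthProj W (orthProj K (orthProj W u))))
  rw [h2, Complex.sub_re, Complex.ofReal_re] at h3
  rcases (norm_nonneg y).eq_or_lt with h | h
  · rw [← h, mul_zero]; exact norm_nonneg _
  · refine le_of_mul_le_mul_left ?_ h
    nlinarith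

/-- On the span of the Ritz vectors with Ritz values in `[s, 1]` the compression of `P` is invertible
with inverse of norm at most `1 / s`. -/
theorem exists_orthProj_orthProj_eq (W : Submodule ℂ H) [FiniteDimensional ℂ W] {s : ℝ} (hs : 0 < s)
    {u : H} (hu : u ∈ ritzSpan (projForm K) W (Icc s 1)) :
    ∃ w ∈ W, orthProj W (orthProj K w) = u ∧ ‖w‖ ≤ s⁻¹ * ‖u‖ := by
  have hq := isHermitianOn_projForm K W
  obtain ⟨e, μ, he⟩ := hq.exists_ritzBasis
  obtain ⟨huW, hu0⟩ := (he.mem_ritzSpan hq).1 hu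
  have hμ : ∀ i, ⟪e i, u⟫_ℂ ≠ 0 → s ≤ μ i := fun i hi => by
    by_contra h
    exact hi (hu0 i fun h' => h h'.1)
  set w := ∑ i, (((μ i)⁻¹ : ℝ) * ⟪e i, u⟫_ℂ) • e i with hw
  have hwW : w ∈ W := he.diag_mem _ _
  refine ⟨w, hwW, eq_orthProj W huW fun v hv => ?_, he.norm_diag_le huW (by positivity) fun i hi => ?_⟩
  · have h1 := he.form_eq_sum hq hwW hv
    rw [projForm] at h1
    rw [inner_sub_right, h1, he.inner_eq_sum huW v, ← Finset.sum_sub_distrib]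
    refine Finset.sum_eq_zero fun i _ => ?_
    rw [hw, he.inner_diag]
    by_cases hi : ⟪e i, u⟫_ℂ = 0
    · simp [hi]
    · have : (μ i : ℂ) ≠ 0 := by exact_mod_cast (hs.trans_le (hμ i hi)).ne'
      push_cast
      field_simp
      ring
  · rw [Complex.norm_real, norm_inv, Real.norm_eq_abs]
    exact inv_anti₀ hs ((hμ i hi).trans (le_abs_self _))

/-- The range of `E P E` is contained in the span of the Ritz vectors with non-zero Ritz values. -/
theorem sandwich_mem_ritzSpan {K : Submodule ℂ H} [FiniteDimensional ℂ K]
    (he : IsRitzBasis (projForm K) V e μ) {γ : ℝ} (hμ : ∀ i, μ i ≠ 0 → γ ≤ μ i) (w : H) :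
    orthProj V (orthProj K (orthProj V w)) ∈ ritzSpan (projForm K) V (Icc γ 1) := by
  have hq := isHermitianOn_projForm K V
  refine (he.mem_ritzSpan hq).2 ⟨orthProj_mem V _, fun i hi => ?_⟩
  have h0 : μ i = 0 := by
    by_contra h
    exact hi ⟨hμ i h, (he.mem_Icc i).2⟩
  have h1 := he.form_left i _ (orthProj_mem V w)
  rw [h0, Complex.ofReal_zero, zero_mul] at h1
  rw [inner_orthProj_right V _ (he.mem i)]
  change projForm K (orthProj V w) (e i) = 0
  rw [← hq.conj_symm _ (orthProj_mem V w) _ (he.mem i), h1, map_zero]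

end Compression

/-! ### Gap convergence -/

theorem delta_nonneg {N : H → ℝ} (hN : ∀ u, 0 ≤ N u) (K M : Submodule ℂ H) : 0 ≤ delta N K M := by
  refine Real.sSup_nonneg ?_
  rintro _ ⟨u, _, _, rfl⟩
  refine Real.sInf_nonneg ?_
  rintro _ ⟨v, _, rfl⟩
  exact hN _

theorem delta_le {N : H → ℝ} (hN : ∀ u, 0 ≤ N u) {K M : Submodule ℂ H} {ε : ℝ} (hε : 0 ≤ ε)
    (h : ∀ u ∈ K, ∃ v ∈ M, N (u - v) ≤ ε * N u) : delta N K M ≤ ε := by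
  refine Real.sSup_le ?_ hε
  rintro _ ⟨u, hu, hu1, rfl⟩
  obtain ⟨v, hv, hle⟩ := h u hu
  rw [hu1, mul_one] at hle
  have hbdd : BddBelow {r | ∃ v ∈ M, r = N (u - v)} := ⟨0, by
    rintro _ ⟨v, _, rfl⟩
    exact hN _⟩
  exact (csInf_le hbdd ⟨v, hv, rfl⟩).trans hle

theorem tendsto_gap {N : H → ℝ} (hN : ∀ u, 0 ≤ N u) {K : ℕ → Submodule ℂ H} {M : Submodule ℂ H}
    {ε : ℕ → ℝ} (hε : ∀ n, 0 ≤ ε n) (hε0 : Tendsto ε atTop (𝓝 0))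
    (h1 : ∀ n, ∀ u ∈ K n, ∃ v ∈ M, N (u - v) ≤ ε n * N u)
    (h2 : ∀ n, ∀ u ∈ M, ∃ v ∈ K n, N (u - v) ≤ ε n * N u) :
    Tendsto (fun n => gap N (K n) M) atTop (𝓝 0) :=
  squeeze_zero (fun _ => (delta_nonneg hN _ _).trans (le_max_left _ _))
    (fun n => max_le (delta_le hN (hε n) (h1 n)) (delta_le hN (hε n) (h2 n))) hε0

section Perturbation

variable [CompleteSpace H] {A : H →ₗ.[ℂ] H} (hA : IsSemibounded A)
  {W : ℕ → Submodule ℂ H} [∀ n, FiniteDimensional ℂ (W n)] (hW : ∀ n, W n ≤ hA.formSubmodule)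
  {C : ℝ} (hC : ∀ n, ∀ u ∈ W n, formNorm A u ≤ C * ‖u‖)
  {V : Submodule ℂ H} [FiniteDimensional ℂ V] {ev : ℝ}
  (hV : ∀ u ∈ V, ∃ h : u ∈ A.domain, A ⟨u, h⟩ = (ev : ℂ) • u)
  (hQ : ∀ u, Tendsto (fun n => formNorm A (orthProj (W n) u - orthProj V u)) atTop (𝓝 0))
  (K : Submodule ℂ H) [FiniteDimensional ℂ K]
  {ι : Type*} [Fintype ι] {e : ι → H} {μ : ι → ℝ} (he : IsRitzBasis (projForm K) V e μ)
  {γ : ℝ} (hγ : 0 < γ) (hμ : ∀ i, μ i ≠ 0 → γ ≤ μ i)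

omit [CompleteSpace H] [FiniteDimensional ℂ V] in
include hA hV in
theorem formNorm_eigenvector {u : H} (hu : u ∈ V) :
    formNorm A u = √(ev - (sInf (spec A) - 1)) * ‖u‖ := by
  obtain ⟨h, h'⟩ := hV u hu
  rw [formNorm, hA.form_of_mem_domain h (hA.domain_le h), h', inner_smul_right, inner_self_eq_ofReal,
    ← Complex.ofReal_mul, Complex.ofReal_re, ← sub_mul, Real.sqrt_mul' _ (sq_nonneg _),
    Real.sqrt_sq (norm_nonneg u)]

include hW hV hQ in
/-- A projection of finite rank turns the strong convergence of the Galerkin projections into uniform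
convergence of the compressions. -/
theorem exists_compression_error : ∃ η : ℕ → ℝ, (∀ n, 0 ≤ η n) ∧ Tendsto η atTop (𝓝 0) ∧
    ∀ n w, w ∈ W n → formNorm A (orthProj (W n) (orthProj K w) -
      orthProj V (orthProj K (orthProj V w))) ≤ η n * ‖w‖ := by
  set f := stdOrthonormalBasis ℂ K
  set D := hA.formSubmodule
  set R := fun (n : ℕ) (u : H) => orthProj (W n) u - orthProj V u with hR
  have hVD : V ≤ D := fun u hu => hA.domain_le (hV u hu).1
  have hRD : ∀ n u, R n u ∈ D := fun n u =>
    D.sub_mem (hW n (orthProj_mem _ u)) (hVD (orthProj_mem V u))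
  set θ := fun n => ∑ j, formNorm A (R n (f j)) with hθ
  set c := √(ev - (sInf (spec A) - 1))
  have hθ0 : ∀ n, 0 ≤ θ n := fun n => Finset.sum_nonneg fun j _ => IsSemibounded.formNorm_nonneg _
  have hθlim : Tendsto θ atTop (𝓝 0) := by
    have := tendsto_finsetSum (Finset.univ) fun j _ => hQ (f j : H)
    simpa using this
  have hPx : ∀ x, orthProj K x = ∑ j, ⟪(f j : H), x⟫_ℂ • (f j : H) := by
    intro x
    have h1 := f.sum_repr' ⟨orthProj K x, orthProj_mem K x⟩
    have h2 := congrArg Subtype.val h1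
    rw [Submodule.coe_sum] at h2
    refine h2.symm.trans ?_
    refine Finset.sum_congr rfl fun j _ => ?_
    rw [Submodule.coe_smul, Submodule.coe_inner, inner_orthProj_right K x (f j).2]
  have hfn : ∀ j, ‖(f j : H)‖ = 1 := fun j => f.orthonormal.1 j
  have hRP : ∀ n x, formNorm A (R n (orthProj K x)) ≤ θ n * ‖x‖ := by
    intro n x
    have : R n (orthProj K x) = ∑ j, ⟪(f j : H), x⟫_ℂ • R n (f j) := by
      conv_lhs => rw [hPx]
      simp only [hR, map_sum, map_smul, ← Finset.sum_sub_distrib, smul_sub]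
    rw [this, hθ, Finset.sum_mul]
    refine (hA.formNorm_sum_le _ fun j => D.smul_mem _ (hRD n _)).trans
      (Finset.sum_le_sum fun j _ => ?_)
    rw [hA.formNorm_smul _ (hRD n _), mul_comm]
    refine mul_le_mul_of_nonneg_left ?_ (IsSemibounded.formNorm_nonneg _)
    simpa [hfn] using norm_inner_le_norm (𝕜 := ℂ) (f j : H) x
  have hPR : ∀ n x, ‖orthProj K (R n x)‖ ≤ θ n * ‖x‖ := by
    intro n x
    rw [hPx, hθ, Finset.sum_mul]
    refine (norm_sum_le _ _).trans (Finset.sum_le_sum fun j _ => ?_)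
    have : ⟪(f j : H), R n x⟫_ℂ = ⟪R n (f j), x⟫_ℂ := by
      simp only [hR, inner_sub_left, inner_sub_right, inner_orthProj_left]
    rw [norm_smul, hfn, mul_one, this]
    exact (norm_inner_le_norm _ _).trans (by
      gcongr
      exact hA.norm_le_formNorm (hRD n _))
  refine ⟨fun n => (1 + c) * θ n, fun n => by have := hθ0 n; positivity, ?_, fun n w hw => ?_⟩
  · simpa using hθlim.const_mul (1 + c)
  · have e1 : orthProj (W n) (orthProj K w) - orthProj V (orthProj K (orthProj V w)) =
        R n (orthProj K w) + orthProj V (orthProj K (R n w)) := by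
      simp only [hR, map_sub, orthProj_eq_self (W n) hw]; abel
    rw [e1]
    refine (hA.formNorm_add_le (hRD n _) (hVD (orthProj_mem V _))).trans ?_
    rw [formNorm_eigenvector hA hV (orthProj_mem V _)]
    have h1 := (norm_orthProj_le V (orthProj K (R n w))).trans (hPR n w)
    calc _ ≤ θ n * ‖w‖ + c * (θ n * ‖w‖) := add_le_add (hRP n w) (by gcongr)
      _ = _ := by ring

include hW hV hQ in
theorem tendsto_compression_eigenvector (u : H) (x : ℝ) (hu : u ∈ V)
    (hux : orthProj V (orthProj K u) = (x : ℂ) • u) :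
    Tendsto (fun n => ‖(x : ℂ) • u - orthProj (W n) (orthProj K (orthProj (W n) u))‖) atTop
      (𝓝 0) := by
  have hVD : V ≤ hA.formSubmodule := fun u hu => hA.domain_le (hV u hu).1
  have hRD : ∀ n u, orthProj (W n) u - orthProj V u ∈ hA.formSubmodule := fun n u =>
    hA.formSubmodule.sub_mem (hW n (orthProj_mem _ u)) (hVD (orthProj_mem V u))
  have h0 := (hQ (orthProj K u)).add (hQ u)
  rw [add_zero] at h0
  refine squeeze_zero (fun _ => norm_nonneg _) (fun n => ?_) h0
  have e1 : (x : ℂ) • u - orthProj (W n) (orthProj K (orthProj (W n) u)) =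
      -((orthProj (W n) (orthProj K u) - orthProj V (orthProj K u)) +
        orthProj (W n) (orthProj K (orthProj (W n) u - orthProj V u))) := by
    rw [← hux, map_sub, map_sub, orthProj_eq_self V hu]; abel
  rw [e1, norm_neg]
  refine (norm_add_le _ _).trans (add_le_add (hA.norm_le_formNorm (hRD n _)) ?_)
  exact ((norm_orthProj_le _ _).trans (norm_orthProj_le _ _)).trans (hA.norm_le_formNorm (hRD n _))

include hW hC hV hQ he hγ

/-- Every vector in the span of the Ritz vectors of `P` on `V` with non-zero Ritz values is
approximated, uniformly on the unit sphere and in the norm of `H_𝔞`, by the corresponding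
vectors of `Wₙ`. -/
theorem exists_lower_error : ∃ η : ℕ → ℝ, (∀ n, 0 ≤ η n) ∧ Tendsto η atTop (𝓝 0) ∧
    ∀ n, ∀ u ∈ ritzSpan (projForm K) V (Icc γ 1),
      ∃ v ∈ ritzSpan (projForm K) (W n) (Icc (γ / 2) 1), formNorm A (u - v) ≤ η n * ‖u‖ := by
  classical
  have hq := isHermitianOn_projForm K V
  set D := hA.formSubmodule
  have hVD : V ≤ D := fun u hu => hA.domain_le (hV u hu).1
  set F := fun n => ritzSpan (projForm K) (W n) (Icc (γ / 2) 1)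
  have hFW : ∀ n, F n ≤ W n := fun n => ritzSpan_le _ _ _
  have hFD : ∀ n u, orthProj (F n) u ∈ D := fun n u => hW n (hFW n (orthProj_mem (F n) u))
  set I := Finset.univ.filter fun i => μ i ∈ Icc γ 1
  have hi : ∀ i ∈ I, Tendsto (fun n => formNorm A (e i - orthProj (F n) (e i))) atTop (𝓝 0) := by
    intro i hi
    have hiγ : γ ≤ μ i := ((Finset.mem_filter.1 hi).2).1
    have h1 : orthProj V (orthProj K (e i)) = (μ i : ℂ) • e i :=
      (orthProj_orthProj_eq_smul_iff K (he.mem i) _).2 (he.form_left i)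
    have h2 := (tendsto_compression_eigenvector hA hW hV hQ K (e i) (μ i) (he.mem i) h1).const_mul
      (|C| * (γ / 2)⁻¹)
    have h3 := h2.add (hQ (e i))
    rw [mul_zero, add_zero] at h3
    refine squeeze_zero (fun _ => IsSemibounded.formNorm_nonneg _) (fun n => ?_) h3
    have h4 := norm_orthProj_sub_ritz_le K (W n) (γ / 2) (μ i) (e i)
    have hQD : orthProj (W n) (e i) ∈ D := hW n (orthProj_mem _ _)
    rw [orthProj_eq_self V (he.mem i), hA.formNorm_sub_rev hQD (hVD (he.mem i)), add_comm]
    refine (hA.formNorm_sub_le (hVD (he.mem i)) hQD (hFD n _)).trans (add_le_add le_rfl ?_)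
    have h5 := hC n _ ((W n).sub_mem (orthProj_mem (W n) (e i)) (hFW n (orthProj_mem (F n) (e i))))
    refine h5.trans ?_
    rw [mul_assoc]
    refine mul_le_mul (le_abs_self C) ?_ (norm_nonneg _) (abs_nonneg _)
    rw [inv_mul_eq_div, le_div_iff₀ (by positivity), mul_comm]
    refine le_trans ?_ h4
    gcongr
    linarith
  refine ⟨fun n => ∑ i ∈ I, formNorm A (e i - orthProj (F n) (e i)),
    fun n => Finset.sum_nonneg fun i _ => IsSemibounded.formNorm_nonneg _, ?_, fun n u hu => ?_⟩
  · have := tendsto_finsetSum I hi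
    simpa using this
  · obtain ⟨huV, hu0⟩ := (he.mem_ritzSpan hq).1 hu
    refine ⟨orthProj (F n) u, orthProj_mem _ _, ?_⟩
    have hu1 : u = ∑ i ∈ I, ⟪e i, u⟫_ℂ • e i := by
      conv_lhs => rw [← he.sum_repr u huV]
      refine (Finset.sum_subset (Finset.subset_univ I) fun i _ hi => ?_).symm
      rw [hu0 i fun h => hi (Finset.mem_filter.2 ⟨Finset.mem_univ i, h⟩), zero_smul]
    have hu2 : u - orthProj (F n) u = ∑ i ∈ I, ⟪e i, u⟫_ℂ • (e i - orthProj (F n) (e i)) := by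
      conv_lhs => rw [hu1]
      simp only [map_sum, map_smul, ← Finset.sum_sub_distrib, smul_sub]
    have hD : ∀ i, e i - orthProj (F n) (e i) ∈ D := fun i => D.sub_mem (hVD (he.mem i)) (hFD n _)
    rw [hu2, Finset.sum_mul]
    refine (hA.formNorm_sum_le _ fun i => D.smul_mem _ (hD i)).trans
      (Finset.sum_le_sum fun i _ => ?_)
    rw [hA.formNorm_smul _ (hD i), mul_comm]
    refine mul_le_mul_of_nonneg_left ?_ (IsSemibounded.formNorm_nonneg _)
    simpa [he.orthonormal.1 i] using norm_inner_le_norm (𝕜 := ℂ) (e i) u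

omit hC in
include hμ in
/-- Every vector in the span of the Ritz vectors of `P` on `Wₙ` with Ritz values at least `γ / 2` is
close, uniformly on the unit sphere and in the norm of `H_𝔞`, to the span of the Ritz vectors on `V`
with non-zero Ritz values: it is `Qₙ P w` for some `w` of comparable norm, which is close
to `E P E w`. -/
theorem exists_upper_error : ∃ η : ℕ → ℝ, (∀ n, 0 ≤ η n) ∧ Tendsto η atTop (𝓝 0) ∧
    ∀ n, ∀ u ∈ ritzSpan (projForm K) (W n) (Icc (γ / 2) 1),
      ∃ v ∈ ritzSpan (projForm K) V (Icc γ 1), formNorm A (u - v) ≤ η n * ‖u‖ := by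
  obtain ⟨η, h1, h2, h3⟩ := exists_compression_error hA hW hV hQ K
  refine ⟨fun n => η n * (γ / 2)⁻¹, fun n => by have := h1 n; positivity,
    by simpa using h2.mul_const (γ / 2)⁻¹, fun n u hu => ?_⟩
  obtain ⟨w, hw, hwu, hwn⟩ := exists_orthProj_orthProj_eq K (W n) (half_pos hγ) hu
  refine ⟨_, sandwich_mem_ritzSpan he hμ w, ?_⟩
  have := h3 n w hw
  rw [hwu] at this
  refine this.trans ?_
  rw [mul_assoc]
  exact mul_le_mul_of_nonneg_left hwn (h1 n)

end Perturbation

/-! ### Galerkin eigenvalues -/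

namespace IsSemibounded

variable {A : H →ₗ.[ℂ] H} (hA : IsSemibounded A)

theorem galerkinSpec_nonempty {F : Submodule ℂ H} [FiniteDimensional ℂ F]
    (hF : F ≤ hA.formSubmodule) (h0 : F ≠ ⊥) : (galerkinSpec A F).Nonempty := by
  obtain ⟨e, μ, he⟩ := (hA.isHermitianOn_form.mono hF).exists_ritzBasis
  obtain ⟨u, hu, hu0⟩ := F.ne_bot_iff.1 h0
  have : ∃ i, ⟪e i, u⟫_ℂ ≠ 0 := by
    by_contra! h
    refine hu0 ?_
    rw [← he.sum_repr u hu]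
    exact Finset.sum_eq_zero fun i _ => by rw [h i, zero_smul]
  obtain ⟨i, -⟩ := this
  exact ⟨μ i, e i, he.orthonormal.ne_zero i, he.mem i, he.form_left i⟩

/-- The Rayleigh quotient of a vector is close to `ev`, to second order in its distance from the
eigenvectors. -/
theorem abs_sub_le_of_mem_galerkinSpec {F M : Submodule ℂ H} (hF : F ≤ hA.formSubmodule) {ev η : ℝ}
    (hM : ∀ u ∈ M, ∃ h : u ∈ A.domain, A ⟨u, h⟩ = (ev : ℂ) • u)
    (h : ∀ u ∈ F, ∃ v ∈ M, formNorm A (u - v) ≤ η * ‖u‖) {x : ℝ} (hx : x ∈ galerkinSpec A F) :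
    |x - ev| ≤ (1 + |sInf (spec A) - 1 - ev|) * η ^ 2 := by
  obtain ⟨u, hu0, hu, hux⟩ := hx
  obtain ⟨v, hv, hle⟩ := h u hu
  obtain ⟨hvd, hve⟩ := hM v hv
  have hq := hA.isHermitianOn_form
  have huD := hF hu
  have hvD := hA.domain_le hvd
  have hr := hA.formSubmodule.sub_mem huD hvD
  -- `v` is an eigenvector, hence orthogonal to everything with respect to the form of `A - ev`
  have h1 : ∀ w ∈ hA.formSubmodule, form A v w - ev * ⟪w, v⟫_ℂ = 0 := fun w hw => by
    rw [hA.form_of_mem_domain hvd hw, hve, inner_smul_right, sub_self]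
  have h2 : form A u v - ev * ⟪v, u⟫_ℂ = 0 := by
    have := congrArg (starRingEnd ℂ) (h1 u huD)
    rwa [map_sub, map_mul, Complex.conj_ofReal, inner_conj_symm, hq.conj_symm u huD v hvD,
      map_zero] at this
  have h3 : form A (u - v) (u - v) - ev * ⟪u - v, u - v⟫_ℂ = (((x - ev) * ‖u‖ ^ 2 : ℝ) : ℂ) := by
    have h4 := h1 (u - v) hr
    rw [hq.sub_right hvD huD hvD, inner_sub_left] at h4
    rw [hq.sub_left huD hvD hr, hq.sub_right huD huD hvD, hq.sub_right hvD huD hvD, inner_sub_left,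
      inner_sub_right, inner_sub_right, hux u hu, inner_self_eq_ofReal]
    rw [Complex.ofReal_mul, Complex.ofReal_sub, ← inner_self_eq_ofReal]
    linear_combination -h4 - h2
  have h5 := hA.norm_form_sub_le ev hr hr
  rw [h3, Complex.norm_real, Real.norm_eq_abs, abs_mul, abs_of_nonneg (sq_nonneg ‖u‖)] at h5
  have hu1 : 0 < ‖u‖ ^ 2 := by have := norm_pos_iff.2 hu0; positivity
  have hN := formNorm_nonneg (A := A) (u - v)
  refine le_of_mul_le_mul_right ?_ hu1
  calc |x - ev| * ‖u‖ ^ 2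
      ≤ (1 + |sInf (spec A) - 1 - ev|) * (formNorm A (u - v) * formNorm A (u - v)) := h5
    _ ≤ (1 + |sInf (spec A) - 1 - ev|) * (η * ‖u‖ * (η * ‖u‖)) :=
        mul_le_mul_of_nonneg_left (mul_le_mul hle hle hN (hN.trans hle)) (by positivity)
    _ = _ := by ring

end IsSemibounded

theorem tendsto_hausdorffEDist_singleton {s : ℕ → Set ℝ} {x : ℝ} {ε : ℕ → ℝ}
    (hε : Tendsto ε atTop (𝓝 0)) (hne : ∀ᶠ n in atTop, (s n).Nonempty)
    (h : ∀ n, ∀ y ∈ s n, |y - x| ≤ ε n) :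
    Tendsto (fun n => Metric.hausdorffEDist (s n) {x}) atTop (𝓝 0) := by
  have h0 : Tendsto (fun n => ENNReal.ofReal (ε n)) atTop (𝓝 0) := by
    simpa using ENNReal.tendsto_ofReal hε
  refine tendsto_of_tendsto_of_tendsto_of_le_of_le' tendsto_const_nhds h0
    (Eventually.of_forall fun _ => zero_le) ?_
  filter_upwards [hne] with n hn
  have hd : ∀ y ∈ s n, edist y x ≤ ENNReal.ofReal (ε n) := fun y hy => by
    rw [edist_dist, Real.dist_eq]
    exact ENNReal.ofReal_le_ofReal (h n y hy)
  refine Metric.hausdorffEDist_le_of_mem_edist (fun y hy => ⟨x, rfl, hd y hy⟩) ?_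
  rintro _ rfl
  obtain ⟨y, hy⟩ := hn
  exact ⟨y, hy, by rw [edist_comm]; exact hd y hy⟩

/-! ### The spectral subspace of an isolated eigenvalue -/

theorem exists_apply_of_mem_spectralSubspace {A : H →ₗ.[ℂ] H} {a b ev : ℝ}
    (hev : Icc a b ∩ spec A = {ev}) {u : H} (hu : u ∈ spectralSubspace A (Icc a b)) :
    ∃ h : u ∈ A.domain, A ⟨u, h⟩ = (ev : ℂ) • u := by
  induction hu using Submodule.span_induction with
  | mem u hu =>
    obtain ⟨μ, hμ, h, h'⟩ := hu
    refine ⟨h, ?_⟩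
    by_cases h0 : u = 0
    · subst h0
      rw [h', smul_zero, smul_zero]
    · have : μ ∈ Icc a b ∩ spec A := ⟨hμ, mem_spec_of_eigenvector h0 h h'⟩
      rw [hev] at this
      rwa [← (show μ = ev from this)]
  | zero => exact ⟨A.domain.zero_mem, by rw [smul_zero]; exact A.map_zero⟩
  | add x y _ _ hx hy =>
    obtain ⟨h, h'⟩ := hx
    obtain ⟨k, k'⟩ := hy
    exact ⟨A.domain.add_mem h k, by
      rw [smul_add, ← h', ← k', ← A.map_add]; rfl⟩
  | smul r x _ hx =>
    obtain ⟨h, h'⟩ := hx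
    exact ⟨A.domain.smul_mem r h, by
      rw [smul_comm, ← h', ← A.map_smul]; rfl⟩

theorem finiteDimensional_spectralSubspace {A : H →ₗ.[ℂ] H} {a b ev : ℝ}
    (hess : essSpec A ∩ Icc a b = ∅) (hev : Icc a b ∩ spec A = {ev}) :
    FiniteDimensional ℂ (spectralSubspace A (Icc a b)) := by
  have h1 : ev ∈ Icc a b ∩ spec A := by rw [hev]; rfl
  have h2 : ev ∈ discSpec A := by
    by_contra h
    have : ev ∈ essSpec A ∩ Icc a b := ⟨⟨h1.2, h⟩, h1.1⟩
    rw [hess] at this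
    exact this
  have := h2.2.2.2
  refine Submodule.finiteDimensional_of_le (S₂ := spectralSubspace A {ev}) fun u hu => ?_
  obtain ⟨h, h'⟩ := exists_apply_of_mem_spectralSubspace hev hu
  exact Submodule.subset_span ⟨ev, rfl, h, h'⟩

end Galerkin

theorem mainTheorem7 {H : Type*} [NormedAddCommGroup H] [InnerProductSpace ℂ H] [CompleteSpace H]
    (hH : ¬ FiniteDimensional ℂ H)
    (A : H →ₗ.[ℂ] H) (hA : IsSelfAdjoint A) (hbdd : Galerkin.BoundedBelow A)
    (a b : ℝ) (hab : a < b) (ha : a ∉ Galerkin.spec A) (hb : b ∉ Galerkin.spec A)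
    (hess : Galerkin.essSpec A ∩ Set.Icc a b = ∅)
    (ev : ℝ) (hev : Set.Icc a b ∩ Galerkin.spec A = {ev})
    (L : ℕ → Submodule ℂ H) (hL : Galerkin.IsTrialSequence A L)
    (K : Submodule ℂ H) [FiniteDimensional ℂ K]
    (E P : H →L[ℂ] H)
    (hE : E = Galerkin.orthProj (Galerkin.spectralSubspace A (Set.Icc a b)))
    (hP : P = Galerkin.orthProj K)
    (hrank : Module.finrank ℂ (P ∘L E).range ≠ 0) :
    ∃ γ : ℝ, IsLeast (Galerkin.discSpec (Galerkin.ofBounded (E ∘L P ∘L E))) γ ∧ 0 < γ ∧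
      ∀ (M : Submodule ℂ H) (Mn : ℕ → Submodule ℂ H),
        M = Galerkin.spectralSubspace (Galerkin.ofBounded (E ∘L P ∘L E)) (Set.Icc γ 1) →
        (∀ n, Mn n = Galerkin.spectralSubspace
          (Galerkin.compression K (Galerkin.galerkinSubspace A (L n) (Set.Icc a b)))
          (Set.Icc (γ / 2) 1)) →
        Module.finrank ℂ M = Module.finrank ℂ (P ∘L E).range ∧
        M ≤ Galerkin.spectralSubspace A (Set.Icc a b) ∧
        Tendsto (fun n => Galerkin.gap (fun u => ‖u‖) (Mn n) M) atTop (𝓝 0) ∧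
        Tendsto (fun n => Galerkin.gap (Galerkin.formNorm A) (Mn n) M) atTop (𝓝 0) ∧
        Tendsto (fun n => Metric.hausdorffEDist (Galerkin.galerkinSpec A (Mn n)) {ev})
          atTop (𝓝 0) := by
  subst hE hP
  have hs := Galerkin.isSymmetric_of_isSelfAdjoint hA
  obtain ⟨B, hB⟩ := Galerkin.exists_isResolvent ha
  have hS := hB.isSemibounded hs hbdd
  obtain ⟨E, S, hE1, hE2, hE3, hES, hSS, hSr⟩ := hB.exists_reducedResolvent hs hb hev
  have hevm : ev ∈ Set.Icc a b ∩ Galerkin.spec A := by rw [hev]; rfl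
  have hae : a < ev := lt_of_le_of_ne hevm.1.1 fun h => ha (h ▸ hevm.2)
  have heb : ev < b := lt_of_le_of_ne hevm.1.2 fun h => hb (h ▸ hevm.2)
  set V := Galerkin.spectralSubspace A (Set.Icc a b) with hVdef
  have : FiniteDimensional ℂ V := Galerkin.finiteDimensional_spectralSubspace hess hev
  have hV : ∀ u ∈ V, ∃ h : u ∈ A.domain, A ⟨u, h⟩ = (ev : ℂ) • u := fun u hu =>
    Galerkin.exists_apply_of_mem_spectralSubspace hev hu
  have hEV : ∀ u, Galerkin.orthProj V u = E u := fun u => by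
    obtain ⟨h, h'⟩ := hE1 u
    refine Galerkin.eq_orthProj V (Submodule.subset_span ⟨ev, hevm.1, h, h'⟩) fun w hw => ?_
    obtain ⟨k, k'⟩ := hV w hw
    rw [inner_sub_right, ← hE3, hE2 w k k', sub_self]
  have hfin := hL.finite
  set W := fun n => Galerkin.galerkinSubspace A (L n) (Set.Icc a b) with hWdef
  have hWfin : ∀ n, FiniteDimensional ℂ (W n) := fun n => inferInstance
  have hLD : ∀ n, L n ≤ hS.formSubmodule := hL.subset
  have hW : ∀ n, W n ≤ hS.formSubmodule := fun n =>
    (Galerkin.galerkinSubspace_le A _ _).trans (hLD n)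
  have hC : ∀ n, ∀ u ∈ W n, Galerkin.formNorm A u ≤
      √(b - (sInf (Galerkin.spec A) - 1)) * ‖u‖ := fun n u hu =>
    hS.formNorm_le_of_mem_galerkinSubspace (hLD n) hu
  have hQ : ∀ u, Tendsto (fun n => Galerkin.formNorm A
      (Galerkin.orthProj (W n) u - Galerkin.orthProj V u)) atTop (𝓝 0) := fun u => by
    rw [hEV]
    exact Galerkin.tendsto_formNorm_orthProj_sub hS hL hae heb hE1 hES hSS hSr u
  obtain ⟨e, μ, he⟩ := (Galerkin.isHermitianOn_projForm K V).exists_ritzBasis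
  -- `γ` is the smallest non-zero Ritz value of `P` on the spectral subspace
  obtain ⟨i₀, hi₀⟩ := Galerkin.exists_ritzValue_ne_zero he hrank
  obtain ⟨i, hi, hmin⟩ := Finset.exists_min_image (Finset.univ.filter fun i => μ i ≠ 0) μ
    ⟨i₀, Finset.mem_filter.2 ⟨Finset.mem_univ _, hi₀⟩⟩
  have hi0 : μ i ≠ 0 := (Finset.mem_filter.1 hi).2
  have hμ : ∀ j, μ j ≠ 0 → μ i ≤ μ j := fun j hj =>
    hmin j (Finset.mem_filter.2 ⟨Finset.mem_univ _, hj⟩)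
  have hγ : 0 < μ i := lt_of_le_of_ne (he.mem_Icc i).1 hi0.symm
  refine ⟨μ i, ⟨(Galerkin.mem_discSpec_sandwich_iff hH he).2 ⟨hi0, i, rfl⟩, fun x hx => ?_⟩, hγ, ?_⟩
  · obtain ⟨hx0, j, rfl⟩ := (Galerkin.mem_discSpec_sandwich_iff hH he).1 hx
    exact hμ j hx0
  intro M Mn hM hMn
  rw [Galerkin.spectralSubspace_sandwich K V (by simp [hγ])] at hM
  have hMn : ∀ n, Mn n = Galerkin.ritzSpan (Galerkin.projForm K) (W n) (Set.Icc (μ i / 2) 1) :=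
    fun n => by rw [hMn n, ← Galerkin.spectralSubspace_compression]
  have hMV : M ≤ V := by rw [hM]; exact Galerkin.ritzSpan_le _ _ _
  have hMnW : ∀ n, Mn n ≤ W n := fun n => by rw [hMn]; exact Galerkin.ritzSpan_le _ _ _
  have hMnD : ∀ n, Mn n ≤ hS.formSubmodule := fun n => (hMnW n).trans (hW n)
  have hMD : M ≤ hS.formSubmodule := fun u hu => hS.domain_le (hV u (hMV hu)).1
  obtain ⟨η₁, hη₁, hη₁', h₁⟩ := Galerkin.exists_upper_error hS hW hV hQ K he hγ hμ
  obtain ⟨η₂, hη₂, hη₂', h₂⟩ := Galerkin.exists_lower_error hS hW hC hV hQ K he hγ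
  rw [← hM] at h₂
  simp only [← hM, ← hMn] at h₁ h₂
  have hη : Tendsto (fun n => η₁ n + η₂ n) atTop (𝓝 0) := by simpa using hη₁'.add hη₂'
  have hη0 : ∀ n, 0 ≤ η₁ n + η₂ n := fun n => add_nonneg (hη₁ n) (hη₂ n)
  have k₁ : ∀ n, ∀ u ∈ Mn n, ∃ v ∈ M, Galerkin.formNorm A (u - v) ≤ (η₁ n + η₂ n) * ‖u‖ :=
    fun n u hu => (h₁ n u hu).imp fun v hv => ⟨hv.1, hv.2.trans (by
      gcongr; exact le_add_of_nonneg_right (hη₂ n))⟩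
  have k₂ : ∀ n, ∀ u ∈ M, ∃ v ∈ Mn n, Galerkin.formNorm A (u - v) ≤ (η₁ n + η₂ n) * ‖u‖ :=
    fun n u hu => (h₂ n u hu).imp fun v hv => ⟨hv.1, hv.2.trans (by
      gcongr; exact le_add_of_nonneg_left (hη₁ n))⟩
  refine ⟨?_, hMV, ?_, ?_, ?_⟩
  · rw [hM]
    exact Galerkin.finrank_ritzSpan_projForm he hγ hμ
  · refine Galerkin.tendsto_gap (fun u => norm_nonneg u) hη0 hη (fun n u hu => ?_)
      fun n u hu => ?_
    · obtain ⟨v, hv, hle⟩ := k₁ n u hu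
      exact ⟨v, hv, (hS.norm_le_formNorm (Submodule.sub_mem _ (hMnD n hu) (hMD hv))).trans hle⟩
    · obtain ⟨v, hv, hle⟩ := k₂ n u hu
      exact ⟨v, hv, (hS.norm_le_formNorm (Submodule.sub_mem _ (hMD hu) (hMnD n hv))).trans hle⟩
  · refine Galerkin.tendsto_gap Galerkin.IsSemibounded.formNorm_nonneg hη0 hη (fun n u hu => ?_)
      fun n u hu => ?_
    · obtain ⟨v, hv, hle⟩ := k₁ n u hu
      exact ⟨v, hv, hle.trans (mul_le_mul_of_nonneg_left (hS.norm_le_formNorm (hMnD n hu)) (hη0 n))⟩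
    · obtain ⟨v, hv, hle⟩ := k₂ n u hu
      exact ⟨v, hv, hle.trans (mul_le_mul_of_nonneg_left (hS.norm_le_formNorm (hMD hu)) (hη0 n))⟩
  · refine Galerkin.tendsto_hausdorffEDist_singleton (ε := fun n =>
      (1 + |sInf (Galerkin.spec A) - 1 - ev|) * (η₁ n + η₂ n) ^ 2) ?_ ?_ fun n y hy =>
        hS.abs_sub_le_of_mem_galerkinSpec (hMnD n) (fun u hu => hV u (hMV hu)) (k₁ n) hy
    · simpa using (hη.pow 2).const_mul (1 + |sInf (Galerkin.spec A) - 1 - ev|)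
    · -- once the error is below one, a non-zero vector of `M` cannot be approximated by zero
      filter_upwards [hη.eventually (gt_mem_nhds one_pos)] with n hn
      have : FiniteDimensional ℂ (Mn n) := Submodule.finiteDimensional_of_le (hMnW n)
      refine hS.galerkinSpec_nonempty (hMnD n) fun hbot => ?_
      have hei : e i ∈ M := by rw [hM]; exact he.basis_mem_ritzSpan ⟨le_rfl, (he.mem_Icc i).2⟩
      obtain ⟨v, hv, hle⟩ := k₂ n _ hei
      rw [hbot, Submodule.mem_bot] at hv
      rw [hv, sub_zero, he.orthonormal.1 i, mul_one] at hle
      have := hS.norm_le_formNorm (hMD hei)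
      rw [he.orthonormal.1 i] at this
      linarith
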